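/- Let $K$ be a local field of characteristic $p>0$, that is, a field of characteristic $p$ complete with respect to a discrete valuation, and assume that its residue field $k$ is perfect. Identify $k$ with its image under the Teichmüller lift, the unique coefficient field of $K$. Let $\pi_K$ be a prime element of $K$, let $K_s$ be a separable closure of $K$, and let $\nu_K$ be the extension to $K_s$ of the valuation of $K$ normalized by $\nu_K(K^\times)=\mathbb Z$. For a finite totally ramified subextension $L/K$ of $K_s/K$ put $\nu_L=[L:K]\,\nu_K$, so that $\nu_L(L^\times)=\mathbb Z$. A ramification break of $L/K$ is a number of the form $\nu_L(\sigma(\pi_L)-\pi_L)-1$, where $\pi_L$ is a prime element of $L$ and $\sigma:L\to K_s$ is a $K$-embedding other than the inclusion. Two subextensions $L_1/K$ and $L_2/K$ are $k$-isomorphic if there is a field isomorphism $\sigma:L_1\to L_2$ such that $\sigma(K)=K$ and $\sigma$ induces the identity map on $k$. Let $b\in\frac1{p-1}\cdot(\mathbb N\smallsetminus p\mathbb N)$ and write $b=\frac{(m-1)p+\lambda}{p-1}$ with integers $m$ and $1\le\lambda\le p-1$. Let $\mathcal S_b$ be the set of $k$-isomorphism classes of totally ramified subextensions of $K_s/K$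 of degree $p$ with ramification break $b$. Let $R=\{\omega_i : i\in I\}\subset k^\times$ be a set of coset representatives for $k^\times/(k^\times)^{(p-1)b}$, and for each $\omega_i\in R$ let $\pi_i\in K_s$ be a root of the polynomial $X^p-\omega_i\pi_K^mX^\lambda-\pi_K$. Then each $K(\pi_i)/K$ is a totally ramified extension of degree $p$ with ramification break $b$, and the map which carries $\omega_i$ to the $k$-isomorphism class of $K(\pi_i)/K$ is a bijection from $R$ to $\mathcal S_b$. Furthermore, $K(\pi_i)/K$ is Galois if and only if $b\in\mathbb N\smallsetminus p\mathbb N$ and $\lambda\omega_i\in(k^\times)^{p-1}$. -/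

import Mathlib

open IsLocalRing Polynomial
open scoped IntermediateField

namespace LocalFieldExt

noncomputable section

/- Throughout, a local field with valuation ring `𝒪` is a field `K` with a valuation subring `𝒪`
that is a complete discrete valuation ring.  Its residue field is `ResidueField 𝒪`, and `Ks` is a
separable closure of `K`. -/

section Residue

variable {K : Type*} [Field K] (p : ℕ) [Fact p.Prime] [CharP K p] (𝒪 : ValuationSubring K)

/-- If `K` has characteristic `p`, so does the residue field. -/
theorem charP_residueField : CharP (ResidueField 𝒪) p := by
  have h0 : ((p : ℕ) : 𝒪) = 0 := Subtype.ext (by simp)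
  have h1 : ((p : ℕ) : ResidueField 𝒪) = 0 := by
    have h2 := congrArg (residue 𝒪) h0
    simpa using h2
  exact (CharP.charP_iff_prime_eq_zero (Fact.out : p.Prime)).mpr h1

variable [IsAdicComplete (maximalIdeal 𝒪) 𝒪] [PerfectField (ResidueField 𝒪)]

/-- The Teichmüller lift `k → 𝒪` of the perfect residue field `k`.  In characteristic `p` it is a
ring homomorphism and identifies `k` with the unique coefficient field of `K`; after the choice of
a prime element `π` this is the identification of `K` with `k((π))`. -/
def teichmuller : ResidueField 𝒪 →* 𝒪 :=
  haveI : CharP (ResidueField 𝒪) p := charP_residueField p 𝒪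
  haveI : CharP (𝒪 ⧸ maximalIdeal 𝒪) p := charP_residueField p 𝒪
  haveI : PerfectRing (ResidueField 𝒪) p := PerfectField.toPerfectRing p
  (Perfection.teichmuller p (maximalIdeal 𝒪)).comp
    (Perfection.lift p (ResidueField 𝒪) (ResidueField 𝒪) (RingHom.id _) :
      ResidueField 𝒪 →+* Perfection (ResidueField 𝒪) p).toMonoidHom

/-- The field automorphism `φ` of `K` is the identity on `k ⊆ K`. -/
def FixesResidueField (φ : K ≃+* K) : Prop :=
  ∀ a : ResidueField 𝒪, φ (teichmuller p 𝒪 a) = teichmuller p 𝒪 a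

variable {𝒪}

/-- The trinomial `X^p - ω π^m X^l - π` over `K`, for `ω ∈ k^×` and `π ∈ 𝒪`. -/
def amanoPolynomial (π : 𝒪) (m l : ℕ) (ω : (ResidueField 𝒪)ˣ) : K[X] :=
  X ^ p - C ((teichmuller p 𝒪 ω : K) * (π : K) ^ m) * X ^ l - C (π : K)

end Residue

section Ramification

variable {K Ks : Type*} [Field K] [Field Ks] [Algebra K Ks]
variable (𝒪 : ValuationSubring K) [IsDiscreteValuationRing 𝒪]

/-- The normalized additive valuation `K^× → ℤ` (with the value `0` at `0`, which is not used). -/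
def ordBase (x : K) : ℤ :=
  -WithZero.log ((IsDiscreteValuationRing.maximalIdeal 𝒪).valuation K x)

open Classical in
/-- The valuation `ν_K` of the separable closure `Ks`, normalized by `ν_K(K^×) = ℤ`: for `x ≠ 0`,
`ν_K(x) = ν_K(N_{K(x)/K}(x)) / [K(x) : K]`. -/
def ord (x : Ks) : WithTop ℚ :=
  if x = 0 then ⊤ else
    (((ordBase 𝒪 (Algebra.norm K (IntermediateField.AdjoinSimple.gen K x)) : ℚ) /
      (Module.finrank K K⟮x⟯ : ℚ) : ℚ) : WithTop ℚ)

/-- `L/K` is finite and totally ramified: `ν_K(L^×) = (1/[L:K])ℤ`, that is, the ramification index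
`(ν_K(L^×) : ν_K(K^×))` equals the degree. -/
def IsTotallyRamified (L : IntermediateField K Ks) : Prop :=
  FiniteDimensional K L ∧
    ∀ r : ℚ, (∃ x ∈ L, ord 𝒪 x = (r : WithTop ℚ)) ↔
      ∃ z : ℤ, r = (z : ℚ) / (Module.finrank K L : ℚ)

/-- The valuation `ν_L` of `Ks` attached to a totally ramified `L/K`, which is normalized by
`ν_L(L^×) = ℤ`. -/
def ordOf (L : IntermediateField K Ks) (x : Ks) : WithTop ℚ :=
  Module.finrank K L • ord 𝒪 x

/-- `b` is a (lower) ramification break of the totally ramified extension `L/K`: it is the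
ramification number `ν_L(σ(π_L) - π_L) - 1` of a `K`-embedding `σ : L → Ks` other than the
inclusion, where `π_L` is a prime element of `L`. -/
def IsRamificationBreak (L : IntermediateField K Ks) (b : ℚ) : Prop :=
  ∃ σ : L →ₐ[K] Ks, σ ≠ L.val ∧ ∃ π : L, ordOf 𝒪 L (π : Ks) = 1 ∧
    ordOf 𝒪 L (σ π - (π : Ks)) = ((b + 1 : ℚ) : WithTop ℚ)

variable (Ks)

/-- The totally ramified subextensions of `Ks/K` of degree `p` with ramification break `b`. -/
def extensionsWithBreak (p : ℕ) (b : ℚ) : Set (IntermediateField K Ks) :=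
  {L | Module.finrank K L = p ∧ IsTotallyRamified 𝒪 L ∧ IsRamificationBreak 𝒪 L b}

end Ramification

section Isomorphism

variable {K Ks : Type*} [Field K] [Field Ks] [Algebra K Ks]
variable (p : ℕ) [Fact p.Prime] [CharP K p] (𝒪 : ValuationSubring K)
variable [IsAdicComplete (maximalIdeal 𝒪) 𝒪] [PerfectField (ResidueField 𝒪)]

/-- `L₁/K` and `L₂/K` are `k`-isomorphic: there is a field isomorphism `σ : L₁ → L₂` with
`σ(K) = K` that induces the identity on `k`. -/
def IsKIsomorphic (L₁ L₂ : IntermediateField K Ks) : Prop :=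
  ∃ (σ : L₁ ≃+* L₂) (φ : K ≃+* K),
    (∀ x : K, σ (algebraMap K L₁ x) = algebraMap K L₂ (φ x)) ∧ FixesResidueField p 𝒪 φ

theorem IsKIsomorphic.refl (L : IntermediateField K Ks) : IsKIsomorphic p 𝒪 L L :=
  ⟨RingEquiv.refl L, RingEquiv.refl K, fun _ => rfl, fun _ => rfl⟩

theorem IsKIsomorphic.symm {L₁ L₂ : IntermediateField K Ks} (h : IsKIsomorphic p 𝒪 L₁ L₂) :
    IsKIsomorphic p 𝒪 L₂ L₁ := by
  obtain ⟨σ, φ, h, hφ⟩ := h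
  refine ⟨σ.symm, φ.symm, fun x => ?_, fun a => ?_⟩
  · rw [RingEquiv.symm_apply_eq, h, RingEquiv.apply_symm_apply]
  · rw [RingEquiv.symm_apply_eq, hφ]

theorem IsKIsomorphic.trans {L₁ L₂ L₃ : IntermediateField K Ks} (h : IsKIsomorphic p 𝒪 L₁ L₂)
    (h' : IsKIsomorphic p 𝒪 L₂ L₃) : IsKIsomorphic p 𝒪 L₁ L₃ := by
  obtain ⟨σ, φ, h, hφ⟩ := h
  obtain ⟨σ', φ', h', hφ'⟩ := h'
  refine ⟨σ.trans σ', φ.trans φ', fun x => ?_, fun a => ?_⟩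
  · rw [RingEquiv.trans_apply, h, h', RingEquiv.trans_apply]
  · rw [RingEquiv.trans_apply, hφ, hφ']

variable (Ks) [IsDiscreteValuationRing 𝒪]

/-- `k`-isomorphism as an equivalence relation on the extensions of degree `p` with break `b`. -/
def kIsoSetoid (b : ℚ) : Setoid (extensionsWithBreak Ks 𝒪 p b) where
  r L₁ L₂ := IsKIsomorphic p 𝒪 L₁.1 L₂.1
  iseqv := ⟨fun L => .refl p 𝒪 L.1, fun h => h.symm, fun h h' => h.trans p 𝒪 h'⟩

/-- The set of `k`-isomorphism classes of totally ramified subextensions of `Ks/K` of degree `p`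
with ramification break `b`. -/
abbrev KIsoClasses (b : ℚ) : Type _ := Quotient (kIsoSetoid Ks p 𝒪 b)

end Isomorphism

end

end LocalFieldExt

/-! Write v = p·ν_K (`ramVal`), so that prime elements of a totally ramified L/K of degree p have
valuation 1, and x ~ y (`Close`) when x and y have the same leading term. Everything rests on one
computation. Let x and x(1+ε) be roots of X^p = ∑ a_i X^i (i < p) in characteristic p. Subtracting
the equations gives x^p ε^p = ∑ a_i x^i ((1+ε)^i - 1), and if the term with index l dominates, then
ε^(p-1) ~ l a_l x^l / x^p (`close_pow_of_roots`). For the trinomial X^p - ω t^m X^l - t and a root π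
this reads ε^(p-1) ~ l ω π^n with n = (m-1)p + l = (p-1)b, so the break is b.

Injectivity. The leading term of gπ/π - 1 is the same for all prime elements of L
(`close_conj_div_sub_one`). A k-isomorphism carries a root for ω₁ to a prime element y of K(ρ₂) that
is a root of a trinomial with the same ω₁ and another prime t' of K. Comparing the two formulas
gives ω₁ y^n ~ ω₂ ρ₂^n, and the residue of y/ρ₂ lies in k, so ω₂ ∈ ω₁ (k^×)^n
(`exists_eq_mul_pow_of_isKIsomorphic`).

Surjectivity. In the equation of a prime element x of L the break forces the dominant middle term to
be a_l x^l with ord a_l = m, so x is an approximate root of a trinomial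
(`exists_trinomial_approximation`). Scaling x by a constant of k moves ω within its class. The
approximation is then improved step by step, with ω fixed and t allowed to vary
(`exists_improved_approximation`), until Krasner's lemma puts an exact root into L. The varying t is
harmless: K is k((t)), so an automorphism of K over k carries any prime element to any other
(`exists_ringEquiv_map_prime`).

Galois criterion. K(π) is Galois exactly when ε^(p-1) ~ l ω π^n can be solved for the leading term
of ε inside K(π), which means that b is an integer and l ω is a (p-1)-st power
(`isGalois_adjoin_root_iff`). -/

namespace LocalFieldExt

/-! ### The normalized valuation of K -/

section Base

variable {K : Type*} [Field K] (𝒪 : ValuationSubring K) [IsDiscreteValuationRing 𝒪]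

theorem ordBase_mul {x y : K} (hx : x ≠ 0) (hy : y ≠ 0) :
    ordBase 𝒪 (x * y) = ordBase 𝒪 x + ordBase 𝒪 y := by
  have h1 := (Valuation.ne_zero_iff ((IsDiscreteValuationRing.maximalIdeal 𝒪).valuation K)).mpr hx
  have h2 := (Valuation.ne_zero_iff ((IsDiscreteValuationRing.maximalIdeal 𝒪).valuation K)).mpr hy
  simp only [ordBase, map_mul, WithZero.log_mul h1 h2]
  ring

theorem ordBase_neg (x : K) : ordBase 𝒪 (-x) = ordBase 𝒪 x := by
  simp [ordBase, Valuation.map_neg]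

theorem ordBase_nonneg_iff {x : K} (hx : x ≠ 0) : 0 ≤ ordBase 𝒪 x ↔ x ∈ 𝒪 := by
  have h1 := (Valuation.ne_zero_iff ((IsDiscreteValuationRing.maximalIdeal 𝒪).valuation K)).mpr hx
  rw [ordBase, le_neg, neg_zero, ← WithZero.log_one, WithZero.log_le_log h1 one_ne_zero]
  constructor
  · intro h
    obtain ⟨y, rfl⟩ := IsDiscreteValuationRing.exists_lift_of_le_one h
    exact y.2
  · intro h
    exact (IsDiscreteValuationRing.maximalIdeal 𝒪).valuation_le_one (K := K) ⟨x, h⟩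

theorem ordBase_pos_iff {x : 𝒪} (hx : x ≠ 0) : 0 < ordBase 𝒪 (x : K) ↔ x ∈ maximalIdeal 𝒪 := by
  have h1 := (Valuation.ne_zero_iff ((IsDiscreteValuationRing.maximalIdeal 𝒪).valuation K)).mpr
    (show (x : K) ≠ 0 by simpa using hx)
  rw [ordBase, lt_neg, neg_zero, ← WithZero.log_one, WithZero.log_lt_log h1 one_ne_zero]
  exact (IsDiscreteValuationRing.maximalIdeal 𝒪).valuation_lt_one_iff_mem (K := K) x

open scoped NNReal in
theorem adicAbv_eq {x : K} (hx : x ≠ 0) :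
    (IsDiscreteValuationRing.maximalIdeal 𝒪).adicAbv (K := K) (one_lt_two : (1 : ℝ≥0) < 2) x =
      (2 : ℝ) ^ (-ordBase 𝒪 x) := by
  have h1 := (Valuation.ne_zero_iff ((IsDiscreteValuationRing.maximalIdeal 𝒪).valuation K)).mpr hx
  change ((WithZeroMulInt.toNNReal (two_ne_zero : (2 : ℝ≥0) ≠ 0) _ : ℝ≥0) : ℝ) = _
  rw [WithZeroMulInt.toNNReal_neg_apply two_ne_zero h1, ordBase, neg_neg]
  push_cast
  congr 1
  generalize (IsDiscreteValuationRing.maximalIdeal 𝒪).valuation K x = z at h1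
  lift z to Multiplicative ℤ using h1
  rfl

theorem mem_pow_maximalIdeal_iff {x : 𝒪} (hx : x ≠ 0) (n : ℕ) :
    x ∈ maximalIdeal 𝒪 ^ n ↔ (n : ℤ) ≤ ordBase 𝒪 (x : K) := by
  have h1 := (Valuation.ne_zero_iff ((IsDiscreteValuationRing.maximalIdeal 𝒪).valuation K)).mpr
    (show (x : K) ≠ 0 by simpa using hx)
  rw [show maximalIdeal 𝒪 = (IsDiscreteValuationRing.maximalIdeal 𝒪).asIdeal from rfl,
    ← IsDedekindDomain.HeightOneSpectrum.intValuation_le_pow_iff_mem,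
    ← IsDedekindDomain.HeightOneSpectrum.valuation_of_algebraMap (K := K), ordBase, le_neg,
    ← WithZero.log_exp (-(n : ℤ)), WithZero.log_le_log h1 (by simp)]
  rfl

theorem ordBase_eq_one_iff {x : 𝒪} : ordBase 𝒪 (x : K) = 1 ↔ Irreducible x := by
  have key {t : 𝒪} (ht : Irreducible t) : ordBase 𝒪 (t : K) = 1 := by
    have h0 := ht.ne_zero
    have hm : maximalIdeal 𝒪 = Ideal.span {t} := ht.maximalIdeal_eq
    have h1 := (ordBase_pos_iff 𝒪 h0).mpr (hm ▸ Ideal.mem_span_singleton_self t)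
    by_contra h2
    have h3 := (mem_pow_maximalIdeal_iff 𝒪 h0 2).mpr (by push_cast; omega)
    rw [hm, Ideal.span_singleton_pow, Ideal.mem_span_singleton] at h3
    obtain ⟨c, hc⟩ := h3
    have h4 : t * (t * c) = t * 1 := by rw [mul_one, ← mul_assoc, ← sq, ← hc]
    exact ht.not_isUnit (IsUnit.of_mul_eq_one c (mul_left_cancel₀ h0 h4))
  refine ⟨fun h => ?_, key⟩
  obtain ⟨t, ht⟩ := IsDiscreteValuationRing.exists_irreducible 𝒪
  have hx : x ≠ 0 := by
    rintro rfl
    simp [ordBase] at h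
  have h1 := (ordBase_pos_iff 𝒪 hx).mp (by omega)
  rw [ht.maximalIdeal_eq, Ideal.mem_span_singleton] at h1
  obtain ⟨u, rfl⟩ := h1
  have hu : u ≠ 0 := right_ne_zero_of_mul hx
  have h2 := ordBase_mul 𝒪 (x := (t : K)) (y := u) (by simpa using ht.ne_zero) (by simpa using hu)
  push_cast at h
  rw [h, key ht] at h2
  have h3 : IsUnit u := by
    by_contra h4
    have := (ordBase_pos_iff 𝒪 hu).mpr ((mem_maximalIdeal u).mpr h4)
    omega
  exact (associated_mul_unit_right t u h3).irreducible ht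

end Base

/-! ### Extension of the valuation to the separable closure -/

section Extension

variable {K : Type*} [Field K] (𝒪 : ValuationSubring K) [IsDiscreteValuationRing 𝒪]
  [IsAdicComplete (maximalIdeal 𝒪) 𝒪]

open scoped NNReal in
-- Bridges adic completeness of 𝒪 and metric completeness of K: for a rapidly Cauchy sequence u, the
-- differences u 0 - u n lie in 𝒪 and form an adically Cauchy sequence there.
theorem completeSpace_adicAbv :
    letI := ((IsDiscreteValuationRing.maximalIdeal 𝒪).adicAbv (K := K)
      (one_lt_two : (1 : ℝ≥0) < 2)).toNormedField
    CompleteSpace K := by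
  have hsub (a b c : K) : -(a - (b - c)) = b - a - c := by ring
  let := ((IsDiscreteValuationRing.maximalIdeal 𝒪).adicAbv (K := K)
      (one_lt_two : (1 : ℝ≥0) < 2)).toNormedField
  have hn (x : K) (hx : x ≠ 0) : ‖x‖ = (2 : ℝ) ^ (-ordBase 𝒪 x) := adicAbv_eq 𝒪 hx
  have hle (x : K) (N : ℕ) (h : ‖x‖ ≤ (2 : ℝ) ^ (-(N : ℤ))) :
      ∃ y : 𝒪, (y : K) = x ∧ y ∈ maximalIdeal 𝒪 ^ N := by
    by_cases hx : x = 0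
    · exact ⟨0, by simp [hx], zero_mem _⟩
    rw [hn x hx, zpow_le_zpow_iff_right₀ one_lt_two, neg_le_neg_iff] at h
    refine ⟨⟨x, (ordBase_nonneg_iff 𝒪 hx).mp (by omega)⟩, rfl, ?_⟩
    rw [mem_pow_maximalIdeal_iff]
    · exact h
    · simpa [Subtype.ext_iff] using hx
  have hge (y : 𝒪) (N : ℕ) (h : y ∈ maximalIdeal 𝒪 ^ N) : ‖(y : K)‖ ≤ (2 : ℝ) ^ (-(N : ℤ)) := by
    by_cases hy : y = 0
    · simp [hy]
    rw [hn _ (by simpa using hy), zpow_le_zpow_iff_right₀ one_lt_two, neg_le_neg_iff]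
    exact (mem_pow_maximalIdeal_iff 𝒪 hy N).mp h
  refine Metric.complete_of_convergent_controlled_sequences (fun N : ℕ => (2 : ℝ) ^ (-(N : ℤ)))
    (fun N => by positivity) fun u hu => ?_
  have hu0 (N n : ℕ) (hn : N ≤ n) : ∃ y : 𝒪, (y : K) = u N - u n ∧ y ∈ maximalIdeal 𝒪 ^ N :=
    hle _ _ (by rw [← dist_eq_norm]; exact (hu N N n le_rfl hn).le)
  choose g hg using fun n => hu0 0 n (Nat.zero_le n)
  obtain ⟨l, hl⟩ := IsPrecomplete.prec (I := maximalIdeal 𝒪) (M := 𝒪) inferInstance (f := g) (by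
    intro a b hab
    rw [smul_eq_mul, Ideal.mul_top, SModEq.sub_mem]
    obtain ⟨y, hy, hy'⟩ := hu0 a b hab
    convert neg_mem hy' using 1
    apply Subtype.ext
    push_cast
    rw [hy, (hg a).1, (hg b).1]
    ring)
  refine ⟨u 0 - l, ?_⟩
  rw [tendsto_iff_norm_sub_tendsto_zero]
  refine squeeze_zero (fun _ => norm_nonneg _) (g := fun N : ℕ => (2 : ℝ) ^ (-(N : ℤ)))
    (fun N => ?_) ?_
  · have := hl N
    rw [smul_eq_mul, Ideal.mul_top, SModEq.sub_mem] at this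
    have h2 := hge _ _ this
    push_cast at h2
    rw [(hg N).1] at h2
    rw [← norm_neg]
    exact (congrArg (fun z : K => ‖z‖) (hsub (u N) (u 0) l)).le.trans h2
  · simp only [zpow_neg, zpow_natCast, ← inv_pow]
    exact tendsto_pow_atTop_nhds_zero_of_lt_one (by norm_num) (by norm_num)

variable {Ks : Type*} [Field Ks] [Algebra K Ks] [Algebra.IsAlgebraic K Ks]

omit [IsAdicComplete (maximalIdeal 𝒪) 𝒪] in
theorem ord_eq_minpoly {x : Ks} (hx : x ≠ 0) : ord 𝒪 x =
    (((ordBase 𝒪 ((minpoly K x).coeff 0) : ℚ) / ((minpoly K x).natDegree : ℚ) : ℚ) :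
      WithTop ℚ) := by
  have hi : IsIntegral K x := Algebra.IsIntegral.isIntegral x
  have h2 : ordBase 𝒪 (Algebra.norm K (IntermediateField.AdjoinSimple.gen K x)) =
      ordBase 𝒪 ((minpoly K x).coeff 0) := by
    have := Algebra.PowerBasis.norm_gen_eq_coeff_zero_minpoly
      (IntermediateField.adjoin.powerBasis hi)
    rw [IntermediateField.adjoin.powerBasis_gen, IntermediateField.minpoly_gen] at this
    rw [this]
    rcases neg_one_pow_eq_or K (IntermediateField.adjoin.powerBasis hi).dim with h | h <;>
      rw [h] <;> simp [ordBase_neg]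
  rw [ord, if_neg hx, IntermediateField.adjoin.finrank hi, h2]

open scoped NNReal in
-- That `ord`, defined through norms, is a valuation is not visible from its definition. Over a
-- complete field the spectral norm is multiplicative and ultrametric, and it is computed by the
-- constant coefficient of the minimal polynomial, as `ord` is. The base 2 is arbitrary.
theorem exists_spectralNorm : ∃ f : Ks → ℝ, (∀ x y, f (x * y) = f x * f y) ∧
    (∀ x y, f (x + y) ≤ max (f x) (f y)) ∧
    ∀ x, x ≠ 0 → ∃ q : ℚ, ord 𝒪 x = q ∧ f x = (2 : ℝ) ^ (-(q : ℝ)) := by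
  let iN := ((IsDiscreteValuationRing.maximalIdeal 𝒪).adicAbv (K := K)
      (one_lt_two : (1 : ℝ≥0) < 2)).toNormedField
  have hn (x : K) (hx : x ≠ 0) : ‖x‖ = (2 : ℝ) ^ (-ordBase 𝒪 x) := adicAbv_eq 𝒪 hx
  let : NontriviallyNormedField K :=
    { iN with
      non_trivial := by
        obtain ⟨t, ht⟩ := IsDiscreteValuationRing.exists_irreducible 𝒪
        have h0 : (t : K) ≠ 0 := by simpa using ht.ne_zero
        refine ⟨(t : K)⁻¹, ?_⟩
        rw [norm_inv, hn _ h0, (ordBase_eq_one_iff 𝒪).mpr ht]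
        norm_num }
  have : IsUltrametricDist K := IsUltrametricDist.isUltrametricDist_of_isNonarchimedean_norm
    ((IsDiscreteValuationRing.maximalIdeal 𝒪).isNonarchimedean_adicAbv
      (K := K) (one_lt_two : (1 : ℝ≥0) < 2))
  have : CompleteSpace K := completeSpace_adicAbv 𝒪
  refine ⟨spectralNorm K Ks, map_mul (spectralMulAlgNorm K Ks), isNonarchimedean_spectralNorm, ?_⟩
  intro x hx
  have hi : IsIntegral K x := Algebra.IsIntegral.isIntegral x
  refine ⟨_, ord_eq_minpoly 𝒪 hx, ?_⟩
  have h0 : (minpoly K x).coeff 0 ≠ 0 := minpoly.coeff_zero_ne_zero hi hx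
  rw [spectralNorm.spectralNorm_eq_norm_coeff_zero_rpow, hn _ h0,
    ← Real.rpow_intCast, ← Real.rpow_mul zero_le_two]
  congr 1
  push_cast
  ring

theorem ord_map_mul (x y : Ks) : ord 𝒪 (x * y) = ord 𝒪 x + ord 𝒪 y := by
  by_cases hx : x = 0
  · simp [hx, ord]
  by_cases hy : y = 0
  · simp [hy, ord]
  obtain ⟨f, hm, -, hf⟩ := exists_spectralNorm 𝒪 (Ks := Ks)
  obtain ⟨a, ha, ha'⟩ := hf x hx
  obtain ⟨b, hb, hb'⟩ := hf y hy
  obtain ⟨c, hc, hc'⟩ := hf (x * y) (mul_ne_zero hx hy)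
  rw [hm, ha', hb', ← Real.rpow_add two_pos, Real.rpow_right_inj two_pos (by norm_num)] at hc'
  rw [ha, hb, hc, ← WithTop.coe_add]
  have : (c : ℝ) = a + b := by linarith
  exact_mod_cast this

theorem ord_map_add (x y : Ks) : min (ord 𝒪 x) (ord 𝒪 y) ≤ ord 𝒪 (x + y) := by
  by_cases hx : x = 0
  · simp [hx]
  by_cases hy : y = 0
  · simp [hy]
  by_cases hxy : x + y = 0
  · simp [hxy, ord]
  obtain ⟨f, -, hm, hf⟩ := exists_spectralNorm 𝒪 (Ks := Ks)
  obtain ⟨a, ha, ha'⟩ := hf x hx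
  obtain ⟨b, hb, hb'⟩ := hf y hy
  obtain ⟨c, hc, hc'⟩ := hf (x + y) hxy
  have := hm x y
  rw [ha', hb', hc', le_max_iff, Real.rpow_le_rpow_left_iff one_lt_two,
    Real.rpow_le_rpow_left_iff one_lt_two, neg_le_neg_iff, neg_le_neg_iff] at this
  rw [ha, hb, hc, min_le_iff, WithTop.coe_le_coe, WithTop.coe_le_coe]
  exact_mod_cast this

omit [IsAdicComplete (maximalIdeal 𝒪) 𝒪] in
theorem ord_algebraMap {x : K} (hx : x ≠ 0) :
    ord 𝒪 (algebraMap K Ks x) = ((ordBase 𝒪 x : ℚ) : WithTop ℚ) := by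
  have h : algebraMap K Ks x ≠ 0 := by simpa using hx
  have h3 : minpoly K (algebraMap K Ks x) = X - C x := minpoly.eq_X_sub_C _ x
  rw [ord_eq_minpoly 𝒪 h, h3]
  simp [ordBase_neg]

end Extension

/-! ### Leading terms in a valued field -/

section Close

variable {F : Type*} [Field F] (v : AddValuation F (WithTop ℚ))

/-- `x` and `y` are nonzero and have the same leading term with respect to `v`. -/
def Close (x y : F) : Prop := 0 < v (x / y - 1)

variable {v}

theorem val_mul_nonneg {x y : F} (hx : 0 ≤ v x) (hy : 0 ≤ v y) : 0 ≤ v (x * y) := by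
  rw [v.map_mul]; exact add_nonneg hx hy

theorem val_mul_pos {x y : F} (hx : 0 < v x) (hy : 0 ≤ v y) : 0 < v (x * y) := by
  rw [v.map_mul]; exact add_pos_of_pos_of_nonneg hx hy

theorem val_natCast_nonneg (n : ℕ) : 0 ≤ v (n : F) := by
  induction n with
  | zero => simp
  | succ n ih => rw [Nat.cast_succ]; exact v.map_le_add ih (by simp)

theorem exists_val_eq {x : F} (hx : x ≠ 0) : ∃ r : ℚ, v x = r := by
  have := v.ne_top_iff.mpr hx
  exact ⟨(v x).untop this, (WithTop.coe_untop _ _).symm⟩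

theorem val_pos_of_pow {x : F} {n : ℕ} (h : 0 < v (x ^ n)) : 0 < v x := by
  by_contra h1
  rw [v.map_pow] at h
  exact h.not_ge (nsmul_nonpos (not_lt.mp h1) n)

theorem val_eq_zero_of_sub_one {x : F} (h : 0 < v (x - 1)) : v x = 0 := by
  have := v.map_eq_of_lt_sub (x := 1) (y := x) (by simpa using h)
  simpa using this

/-- An inverse of i modulo p lifts to a natural number; both valuations are nonnegative and their
sum is v 1 = 0. -/
theorem val_natCast (p : ℕ) [Fact p.Prime] [CharP F p] {i : ℕ} (hi : ¬ p ∣ i) :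
    v (i : F) = 0 := by
  have hc : i.Coprime p := ((Fact.out : p.Prime).coprime_iff_not_dvd.mpr hi).symm
  have h0 : ((i : ZMod p)) * ((i : ZMod p)⁻¹) = 1 := ZMod.coe_mul_inv_eq_one i hc
  have h1 : (i : F) * (((i : ZMod p)⁻¹).val : F) = 1 := by
    have := congrArg (ZMod.castHom (dvd_refl p) F) h0
    rw [map_mul, map_natCast, map_one] at this
    rw [← this, ← map_natCast (ZMod.castHom (dvd_refl p) F) ((i : ZMod p)⁻¹).val,
      ZMod.natCast_zmod_val]
  have h2 := congrArg v h1
  rw [v.map_mul, v.map_one] at h2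
  have h3 := val_natCast_nonneg (v := v) i
  have h4 := val_natCast_nonneg (v := v) ((i : ZMod p)⁻¹).val
  refine le_antisymm ?_ h3
  rw [← h2]
  exact le_add_of_nonneg_right h4

namespace Close

variable {x y z x' y' : F}

theorem ne_right (h : Close v x y) : y ≠ 0 := by
  rintro rfl
  simp [Close] at h

theorem ne_left (h : Close v x y) : x ≠ 0 := by
  rintro rfl
  simp [Close] at h

theorem refl (hx : x ≠ 0) : Close v x x := by
  simp [Close, div_self hx]

theorem mul (h : Close v x y) (h' : Close v x' y') : Close v (x * x') (y * y') := by
  have : x * x' / (y * y') - 1 = (x / y - 1) * (x' / y' - 1) + (x / y - 1) + (x' / y' - 1) := by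
    rw [mul_div_mul_comm]; ring
  rw [Close, this]
  exact v.map_lt_add (v.map_lt_add (val_mul_pos h (le_of_lt h')) h) h'

theorem inv (h : Close v x y) : Close v x⁻¹ y⁻¹ := by
  have hx := h.ne_left
  have hy := h.ne_right
  have h0 : v (x / y) = 0 := val_eq_zero_of_sub_one h
  have : x⁻¹ / y⁻¹ - 1 = -((x / y - 1) * (x / y)⁻¹) := by
    field_simp
    ring
  rw [Close, this, v.map_neg]
  exact val_mul_pos h (by rw [v.map_inv, h0]; simp)

theorem symm (h : Close v x y) : Close v y x := by
  have h1 := h.inv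
  have hx := h.ne_left
  have hy := h.ne_right
  rwa [Close, inv_div_inv] at h1

theorem trans (h : Close v x y) (h' : Close v y z) : Close v x z := by
  have h1 := h.mul h'
  have hy := h'.ne_left
  rw [Close] at h1 ⊢
  convert h1 using 3
  have := h'.ne_right
  field_simp

theorem div (h : Close v x y) (h' : Close v x' y') : Close v (x / x') (y / y') := by
  rw [div_eq_mul_inv, div_eq_mul_inv]
  exact h.mul h'.inv

theorem pow (h : Close v x y) (n : ℕ) : Close v (x ^ n) (y ^ n) := by
  induction n with
  | zero => simpa using refl one_ne_zero
  | succ n ih => rw [pow_succ, pow_succ]; exact ih.mul h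

theorem val_eq (h : Close v x y) : v x = v y := by
  have h0 : v (x / y) = 0 := val_eq_zero_of_sub_one h
  have : x = x / y * y := by rw [div_mul_cancel₀ _ h.ne_right]
  rw [this, v.map_mul, h0, zero_add]

theorem of_lt (h : v y < v (x - y)) : Close v x y := by
  have hy : y ≠ 0 := by
    rintro rfl
    simp at h
  have h1 : x / y - 1 = (x - y) / y := by field_simp
  obtain ⟨r, hr⟩ := exists_val_eq (v := v) hy
  have h2 : v (x - y) = v ((x - y) / y) + v y := by
    rw [← v.map_mul, div_mul_cancel₀ _ hy]
  rw [Close, h1]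
  by_contra h3
  rw [h2] at h
  refine h.not_ge ?_
  calc v ((x - y) / y) + v y ≤ 0 + v y := by gcongr; exact not_lt.mp h3
    _ = v y := zero_add _

theorem lt (h : Close v x y) : v y < v (x - y) := by
  obtain ⟨r, hr⟩ := exists_val_eq (v := v) h.ne_right
  have h1 : x - y = (x / y - 1) * y := by
    rw [sub_mul, div_mul_cancel₀ _ h.ne_right, one_mul]
  rw [h1, v.map_mul, hr]
  have h2 := h
  rw [Close] at h2
  generalize v (x / y - 1) = s at h2
  induction s with
  | top => simp
  | coe s =>
    rw [← WithTop.coe_zero, WithTop.coe_lt_coe] at h2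
    rw [← WithTop.coe_add, WithTop.coe_lt_coe]
    linarith

theorem one_iff : Close v x 1 ↔ 0 < v (x - 1) := by
  simp [Close]

end Close

/-- Powers of `1 + ε` up to second order. -/
theorem one_add_pow_eq {ε : F} (hε : 0 ≤ v ε) (i : ℕ) :
    ∃ c, 0 ≤ v c ∧ (1 + ε) ^ i = 1 + i * ε + ε ^ 2 * c := by
  induction i with
  | zero => exact ⟨0, by simp, by simp⟩
  | succ i ih =>
    obtain ⟨c, hc, h⟩ := ih
    refine ⟨c + i + ε * c, ?_, ?_⟩
    · exact v.map_le_add (v.map_le_add hc (val_natCast_nonneg i)) (val_mul_nonneg hε hc)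
    · rw [pow_succ, h]
      push_cast
      ring

/-- If `x` and `y = x (1 + ε)` are roots of `X ^ p - ∑ a i X ^ i` and the terms `a i x ^ i`, `i ≥ 1`,
are dominated by that with `i = l`, this determines the leading term of `ε ^ (p - 1)`. -/
theorem close_pow_of_roots (p : ℕ) [Fact p.Prime] [CharP F p] {x ε : F} (a : ℕ → F) {l : ℕ}
    (hx0 : x ≠ 0) (hε0 : ε ≠ 0) (hε : 0 ≤ v ε)
    (hx : x ^ p = ∑ i ∈ Finset.range p, a i * x ^ i)
    (hy : (x * (1 + ε)) ^ p = ∑ i ∈ Finset.range p, a i * (x * (1 + ε)) ^ i)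
    (hl : 1 ≤ l) (hlp : l < p) (hl0 : a l ≠ 0) (hpl : v (x ^ p) < v (a l * x ^ l))
    (hi : ∀ i, 1 ≤ i → i < p → i ≠ l → v (a l * x ^ l) < v (a i * x ^ i)) :
    0 < v ε ∧ Close v (ε ^ (p - 1)) (l * (a l * x ^ l) / x ^ p) := by
  have hp : p.Prime := Fact.out
  have hlp' : v (l : F) = 0 := val_natCast p (fun h => by
    have := Nat.le_of_dvd (by omega) h
    omega)
  have hl0' : (l : F) ≠ 0 := by
    rw [← v.ne_top_iff, hlp']
    simp
  set c := a l * x ^ l with hc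
  have hc0 : c ≠ 0 := mul_ne_zero hl0 (pow_ne_zero _ hx0)
  choose d hd hd' using fun i => one_add_pow_eq hε i
  have hdiv {s t : F} (hs : s ≠ 0) (h : v s < v t) : 0 < v (t / s) := by
    have := (Close.of_lt (v := v) (x := s + t) (y := s) (by simpa using h))
    rwa [Close, add_div, div_self hs, add_sub_cancel_left] at this
  have hq : 0 < v (c / x ^ p) := hdiv (pow_ne_zero _ hx0) hpl
  have hr (i : ℕ) (h1 : 1 ≤ i) (h2 : i < p) (h3 : i ≠ l) : 0 < v (a i * x ^ i / c) :=
    hdiv hc0 (hi i h1 h2 h3)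
  -- Difference of the two root equations, divided by x^p ε. Additivity of the p-th power leaves
  -- only ε^p on the left.
  have key : ε ^ (p - 1) = c / x ^ p *
      ∑ i ∈ Finset.range p, a i * x ^ i / c * (i + ε * d i) := by
    have h1 : x ^ p * ε ^ p = ∑ i ∈ Finset.range p, a i * x ^ i * (ε * (i + ε * d i)) := by
      have h2 : x ^ p * ε ^ p = (x * (1 + ε)) ^ p - x ^ p := by
        have : ExpChar F p := ExpChar.prime hp
        rw [mul_pow, add_pow_expChar]; ring
      rw [h2, hy, hx, ← Finset.sum_sub_distrib]
      refine Finset.sum_congr rfl fun i _ => ?_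
      rw [mul_pow, hd']; ring
    have h3 : ε ^ p = ε ^ (p - 1) * ε := by
      rw [← pow_succ, Nat.sub_add_cancel hp.one_le]
    rw [h3] at h1
    have h4 : x ^ p ≠ 0 := pow_ne_zero _ hx0
    apply mul_left_cancel₀ (mul_ne_zero h4 hε0)
    calc x ^ p * ε * ε ^ (p - 1) = x ^ p * (ε ^ (p - 1) * ε) := by ring
      _ = _ := h1
      _ = _ := by
        rw [Finset.mul_sum, Finset.mul_sum]
        refine Finset.sum_congr rfl fun i _ => ?_
        field_simp
  have hS : ∑ i ∈ Finset.range p, a i * x ^ i / c * (i + ε * d i) = l + ε * d l +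
      ∑ i ∈ (Finset.range p).erase l, a i * x ^ i / c * (i + ε * d i) := by
    rw [← Finset.add_sum_erase _ _ (Finset.mem_range.mpr hlp), ← hc, div_self hc0, one_mul]
  have hterm (i : ℕ) : 0 ≤ v ((i : F) + ε * d i) :=
    v.map_le_add (val_natCast_nonneg i) (val_mul_nonneg hε (hd i))
  -- The constant term cancels in the difference, so nothing has to be assumed about the size of a
  -- 0.
  have hd0 : ε * d 0 = 0 := by
    have := hd' 0
    simp only [pow_zero, Nat.cast_zero, zero_mul, add_zero, left_eq_add] at this
    rcases mul_eq_zero.mp this with h | h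
    · exact absurd (pow_eq_zero_iff two_ne_zero |>.mp h) hε0
    · rw [h, mul_zero]
  have herase : 0 < v (∑ i ∈ (Finset.range p).erase l, a i * x ^ i / c * (i + ε * d i)) := by
    refine v.map_lt_sum (by simp) fun i hi => ?_
    rw [Finset.mem_erase, Finset.mem_range] at hi
    rcases Nat.eq_zero_or_pos i with rfl | h
    · simp [hd0]
    · exact val_mul_pos (hr i h hi.2 hi.1) (hterm i)
  -- Only v ε ≥ 0 is known so far; the factor c / x^p of positive valuation improves this.
  have hpos : 0 < v ε := by
    apply val_pos_of_pow (n := p - 1)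
    rw [key, hS]
    exact val_mul_pos hq (v.map_le_add (hterm l) herase.le)
  refine ⟨hpos, ?_⟩
  rw [key, show (l : F) * c / x ^ p = c / x ^ p * l by ring]
  refine (Close.refl (div_ne_zero hc0 (pow_ne_zero _ hx0))).mul (Close.of_lt ?_)
  rw [hS, hlp', add_assoc, add_sub_cancel_left]
  exact v.map_lt_add (val_mul_pos hpos (hd l)) herase

/-- The elements of a finite set of values are pairwise distinct: the valuation of a sum does not
exceed that of any term. -/
theorem val_sum_le {ι : Type*} (s : Finset ι) (f : ι → F)
    (h : ∀ i ∈ s, ∀ j ∈ s, f i ≠ 0 → v (f i) = v (f j) → i = j) {i : ι} (hi : i ∈ s) :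
    v (∑ j ∈ s, f j) ≤ v (f i) := by
  classical
  obtain ⟨j, hj, hmin⟩ := s.exists_min_image (fun i => v (f i)) ⟨i, hi⟩
  refine le_trans ?_ (hmin i hi)
  by_cases h0 : f j = 0
  · rw [h0, v.map_zero]; exact le_top
  rw [← Finset.add_sum_erase _ _ hj, v.map_add_eq_of_lt_left]
  refine v.map_lt_sum (v.ne_top_iff.mpr h0) fun k hk => ?_
  rw [Finset.mem_erase] at hk
  exact lt_of_le_of_ne (hmin k hk.2) fun he => hk.1 (h j hj k hk.2 h0 he).symm

end Close

/-! ### Ramified extensions of degree p: expansions, conjugates, Krasner's lemma -/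

section RamVal

variable {K : Type*} [Field K] (p : ℕ) [hp : Fact p.Prime]
  (𝒪 : ValuationSubring K) [IsDiscreteValuationRing 𝒪] [IsAdicComplete (maximalIdeal 𝒪) 𝒪]
  (Ks : Type*) [Field Ks] [Algebra K Ks] [Algebra.IsAlgebraic K Ks]

/-- The valuation of `Ks` for which prime elements of `K` have valuation `p`. -/
noncomputable def ramVal : AddValuation Ks (WithTop ℚ) :=
  AddValuation.of (fun x => p • ord 𝒪 x)
    (by
      obtain ⟨k, hk⟩ := Nat.exists_eq_succ_of_ne_zero hp.out.ne_zero
      rw [hk, succ_nsmul, ord, if_pos rfl, add_top])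
    (by
      have := ord_algebraMap 𝒪 (Ks := Ks) (x := (1 : K)) one_ne_zero
      rw [map_one] at this
      rw [this]
      simp [ordBase])
    (fun x y => by
      rcases min_le_iff.mp (ord_map_add 𝒪 x y) with h | h
      · exact min_le_iff.mpr (Or.inl (nsmul_le_nsmul_right h p))
      · exact min_le_iff.mpr (Or.inr (nsmul_le_nsmul_right h p)))
    (fun x y => by rw [ord_map_mul, nsmul_add])

variable {Ks}

theorem ramVal_apply (x : Ks) : ramVal p 𝒪 Ks x = p • ord 𝒪 x := rfl

theorem ordOf_eq_ramVal {L : IntermediateField K Ks} (hL : Module.finrank K L = p) (x : Ks) :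
    ordOf 𝒪 L x = ramVal p 𝒪 Ks x := by
  rw [ordOf, hL, ramVal_apply]

theorem ord_eq_coe_iff (x : Ks) (r : ℚ) :
    ord 𝒪 x = (r : WithTop ℚ) ↔ ramVal p 𝒪 Ks x = ((p * r : ℚ) : WithTop ℚ) := by
  have h0 : (p : ℚ) ≠ 0 := by exact_mod_cast hp.out.ne_zero
  by_cases hx : x = 0
  · rw [hx, AddValuation.map_zero, ord, if_pos rfl]
    exact iff_of_false WithTop.top_ne_coe WithTop.top_ne_coe
  · rw [ramVal_apply, ord_eq_minpoly 𝒪 hx, ← WithTop.coe_nsmul, WithTop.coe_inj, WithTop.coe_inj,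
      nsmul_eq_mul, mul_right_inj' h0]

theorem ramVal_algebraMap {a : K} (ha : a ≠ 0) :
    ramVal p 𝒪 Ks (algebraMap K Ks a) = ((p * ordBase 𝒪 a : ℚ) : WithTop ℚ) := by
  rw [← ord_eq_coe_iff, ord_algebraMap 𝒪 ha]

theorem ramVal_nonneg_iff (a : K) : 0 ≤ ramVal p 𝒪 Ks (algebraMap K Ks a) ↔ a ∈ 𝒪 := by
  by_cases ha : a = 0
  · simp [ha]
  have h0 : (0 : ℚ) < p := by exact_mod_cast hp.out.pos
  rw [ramVal_algebraMap p 𝒪 ha, ← WithTop.coe_zero, WithTop.coe_le_coe, mul_nonneg_iff_of_pos_left h0,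
    ← ordBase_nonneg_iff 𝒪 ha]
  exact_mod_cast Iff.rfl

theorem ramVal_eq_prime_iff (a : 𝒪) :
    ramVal p 𝒪 Ks (algebraMap K Ks a) = (p : ℚ) ↔ Irreducible a := by
  have h0 : (p : ℚ) ≠ 0 := by exact_mod_cast hp.out.ne_zero
  by_cases ha : a = 0
  · simp [ha]
  rw [ramVal_algebraMap p 𝒪 (by simpa using ha), ← ordBase_eq_one_iff, WithTop.coe_inj,
    mul_eq_left₀ h0]
  exact_mod_cast Iff.rfl

theorem ramVal_pos_iff (a : 𝒪) :
    0 < ramVal p 𝒪 Ks (algebraMap K Ks a) ↔ a ∈ maximalIdeal 𝒪 := by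
  have h0 : (0 : ℚ) < p := by exact_mod_cast hp.out.pos
  by_cases ha : a = 0
  · simp [ha]
  rw [ramVal_algebraMap p 𝒪 (by simpa using ha), ← ordBase_pos_iff 𝒪 ha, ← WithTop.coe_zero,
    WithTop.coe_lt_coe, mul_pos_iff_of_pos_left h0]
  exact_mod_cast Iff.rfl

theorem ramVal_eq_zero_of_isUnit {a : 𝒪} (ha : IsUnit a) :
    ramVal p 𝒪 Ks (algebraMap K Ks a) = 0 := by
  have h1 := (ramVal_nonneg_iff p 𝒪 (Ks := Ks) a).mpr a.2
  have h2 := (ramVal_pos_iff p 𝒪 (Ks := Ks) a).not.mpr (by simpa [mem_maximalIdeal] using ha)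
  exact le_antisymm (not_lt.mp h2) h1

theorem ramVal_eq_of_minpoly_eq {x y : Ks} (h : minpoly K x = minpoly K y) :
    ramVal p 𝒪 Ks x = ramVal p 𝒪 Ks y := by
  have hxy : x = 0 ↔ y = 0 := by
    rw [← minpoly.coeff_zero_eq_zero (A := K) (Algebra.IsIntegral.isIntegral x), h,
      minpoly.coeff_zero_eq_zero (Algebra.IsIntegral.isIntegral y)]
  by_cases hx : x = 0
  · rw [hx, hxy.mp hx]
  rw [ramVal_apply, ramVal_apply, ord_eq_minpoly 𝒪 hx, ord_eq_minpoly 𝒪 (mt hxy.mpr hx), h]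

theorem ramVal_algEquiv (g : Ks ≃ₐ[K] Ks) (x : Ks) :
    ramVal p 𝒪 Ks (g x) = ramVal p 𝒪 Ks x :=
  ramVal_eq_of_minpoly_eq p 𝒪 (minpoly.algEquiv_eq g x)

/-- An element whose valuation is that of a prime element of a ramified extension of degree `p`
has degree divisible by `p`. -/
theorem dvd_finrank_adjoin {x : Ks} (hx : ramVal p 𝒪 Ks x = (1 : ℚ)) :
    p ∣ Module.finrank K K⟮x⟯ := by
  have hi : IsIntegral K x := Algebra.IsIntegral.isIntegral x
  have hx0 : x ≠ 0 := by rintro rfl; simp at hx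
  rw [ramVal_apply, ord_eq_minpoly 𝒪 hx0, ← WithTop.coe_nsmul, WithTop.coe_inj, nsmul_eq_mul,
    ← mul_div_assoc, div_eq_one_iff_eq (by exact_mod_cast (minpoly.natDegree_pos hi).ne')] at hx
  rw [IntermediateField.adjoin.finrank hi]
  have h : (p : ℤ) ∣ ((minpoly K x).natDegree : ℤ) := ⟨_, by exact_mod_cast hx.symm⟩
  exact_mod_cast h

variable {L : IntermediateField K Ks} {π : Ks}

theorem adjoin_eq_of_finrank (hL : Module.finrank K L = p) (hπL : π ∈ L)
    (hπ : ramVal p 𝒪 Ks π = (1 : ℚ)) : K⟮π⟯ = L := by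
  have hle : K⟮π⟯ ≤ L := IntermediateField.adjoin_simple_le_iff.mpr hπL
  have : FiniteDimensional K L := Module.finite_of_finrank_pos (hL ▸ hp.out.pos)
  refine IntermediateField.eq_of_le_of_finrank_le hle ?_
  rw [hL]
  exact Nat.le_of_dvd (Nat.pos_of_ne_zero fun h => by
    have := IntermediateField.finrank_le_of_le_right hle
    have h3 : 0 < Module.finrank K K⟮π⟯ := by
      rw [IntermediateField.adjoin.finrank (Algebra.IsIntegral.isIntegral π)]
      exact minpoly.natDegree_pos (Algebra.IsIntegral.isIntegral π)
    omega) (dvd_finrank_adjoin p 𝒪 hπ)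

/-- The denominator of `ord` at x divides [K(x) : K], which divides p; conversely the integral
powers of π realize every multiple of 1/p. -/
theorem isTotallyRamified_of_finrank (hL : Module.finrank K L = p) (hπL : π ∈ L)
    (hπ : ramVal p 𝒪 Ks π = (1 : ℚ)) : IsTotallyRamified 𝒪 L := by
  have : FiniteDimensional K L := Module.finite_of_finrank_pos (hL ▸ hp.out.pos)
  have h0 : (p : ℚ) ≠ 0 := by exact_mod_cast hp.out.ne_zero
  have hπ0 : π ≠ 0 := by rintro rfl; simp at hπ
  refine ⟨this, fun r => ⟨?_, ?_⟩⟩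
  · rintro ⟨x, hxL, hx⟩
    have hi : IsIntegral K x := Algebra.IsIntegral.isIntegral x
    have hx0 : x ≠ 0 := by
      rintro rfl
      rw [ord, if_pos rfl] at hx
      exact absurd hx (by simp)
    have hd : Module.finrank K K⟮x⟯ ∣ Module.finrank K L := by
      have hle : K⟮x⟯ ≤ L := IntermediateField.adjoin_simple_le_iff.mpr hxL
      exact IntermediateField.finrank_dvd_of_le_right hle
    rw [IntermediateField.adjoin.finrank hi] at hd
    obtain ⟨e, he⟩ := hd
    rw [ord_eq_minpoly 𝒪 hx0, WithTop.coe_inj] at hx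
    refine ⟨ordBase 𝒪 ((minpoly K x).coeff 0) * e, ?_⟩
    have h1 : (0 : ℚ) < (minpoly K x).natDegree := by exact_mod_cast minpoly.natDegree_pos hi
    have h2 : (e : ℚ) ≠ 0 := by
      rintro h
      rw [Nat.cast_eq_zero] at h
      rw [h, mul_zero, hL] at he
      exact hp.out.ne_zero he
    rw [← hx, he]
    push_cast
    field_simp
  · rintro ⟨z, rfl⟩
    refine ⟨π ^ z, zpow_mem hπL z, ?_⟩
    rw [ord_eq_coe_iff p, hL, mul_div_cancel₀ _ h0]
    have hn (n : ℕ) : ramVal p 𝒪 Ks (π ^ n) = ((n : ℚ) : WithTop ℚ) := by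
      rw [AddValuation.map_pow, hπ, ← WithTop.coe_nsmul, nsmul_eq_mul, mul_one]
    obtain ⟨n, rfl | rfl⟩ := z.eq_nat_or_neg
    · rw [zpow_natCast, hn]; simp
    · rw [zpow_neg, zpow_natCast, AddValuation.map_inv, hn]
      push_cast
      rfl

theorem ramVal_term (hπ : ramVal p 𝒪 Ks π = (1 : ℚ)) {a : K} (ha : a ≠ 0) (i : ℕ) :
    ramVal p 𝒪 Ks (algebraMap K Ks a * π ^ i) = ((p * ordBase 𝒪 a + i : ℚ) : WithTop ℚ) := by
  rw [AddValuation.map_mul, ramVal_algebraMap p 𝒪 ha, AddValuation.map_pow, hπ,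
    ← WithTop.coe_nsmul, nsmul_eq_mul, mul_one, WithTop.coe_add]

/-- The valuation of a π^i is congruent to i modulo p. Hence terms with different exponents below p
never cancel. -/
theorem ramVal_term_injective (hπ : ramVal p 𝒪 Ks π = (1 : ℚ)) {a b : K} {i j : ℕ}
    (ha : a ≠ 0) (hi : i < p) (hj : j < p)
    (h : ramVal p 𝒪 Ks (algebraMap K Ks a * π ^ i) = ramVal p 𝒪 Ks (algebraMap K Ks b * π ^ j)) :
    i = j := by
  have hπ0 : π ≠ 0 := by rintro rfl; simp at hπ
  have hb : b ≠ 0 := by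
    rintro rfl
    rw [ramVal_term p 𝒪 hπ ha, map_zero, zero_mul, AddValuation.map_zero] at h
    exact WithTop.coe_ne_top h
  rw [ramVal_term p 𝒪 hπ ha, ramVal_term p 𝒪 hπ hb, WithTop.coe_inj] at h
  have h' : (p : ℤ) * ordBase 𝒪 a + i = p * ordBase 𝒪 b + j := by exact_mod_cast h
  have h2 := congrArg (· % (p : ℤ)) h'
  simp only [Int.mul_add_emod_self_left] at h2
  rw [Int.emod_eq_of_lt (by omega) (by omega), Int.emod_eq_of_lt (by omega) (by omega)] at h2
  exact_mod_cast h2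

/-- Expansion of the elements of `L` in powers of a prime element. -/
theorem exists_expansion (hL : Module.finrank K L = p) (hπL : π ∈ L)
    (hπ : ramVal p 𝒪 Ks π = (1 : ℚ)) {y : Ks} (hy : y ∈ L) :
    ∃ a : ℕ → K, y = ∑ i ∈ Finset.range p, algebraMap K Ks (a i) * π ^ i ∧
      ∀ i < p, ramVal p 𝒪 Ks y ≤ ramVal p 𝒪 Ks (algebraMap K Ks (a i) * π ^ i) := by
  have hi : IsIntegral K π := Algebra.IsIntegral.isIntegral π
  rw [← adjoin_eq_of_finrank p 𝒪 hL hπL hπ] at hy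
  have hd : (minpoly K π).natDegree = p := by
    rw [← IntermediateField.adjoin.finrank hi, adjoin_eq_of_finrank p 𝒪 hL hπL hπ, hL]
  obtain ⟨f, hf, hfy⟩ := (IntermediateField.adjoin.powerBasis hi).exists_eq_aeval
    (⟨y, hy⟩ : K⟮π⟯)
  rw [IntermediateField.adjoin.powerBasis_dim, hd] at hf
  rw [IntermediateField.adjoin.powerBasis_gen] at hfy
  have hy' : y = ∑ i ∈ Finset.range p, algebraMap K Ks (f.coeff i) * π ^ i := by
    have h1 := congrArg (algebraMap K⟮π⟯ Ks) hfy
    rw [← Polynomial.aeval_algebraMap_apply, IntermediateField.AdjoinSimple.algebraMap_gen,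
      aeval_eq_sum_range' hf] at h1
    simpa [Algebra.smul_def] using h1
  refine ⟨f.coeff, hy', fun i hi => ?_⟩
  conv_lhs => rw [hy']
  refine val_sum_le (Finset.range p) (fun i => algebraMap K Ks (f.coeff i) * π ^ i) ?_
    (Finset.mem_range.mpr hi)
  intro i hi j hj h0 h
  refine ramVal_term_injective p 𝒪 hπ ?_ (Finset.mem_range.mp hi) (Finset.mem_range.mp hj) h
  rintro h1
  simp [h1] at h0

/-- L has the same residue field as K: the constant term of the π-expansion is the required e,
because every other term has valuation nonzero modulo p. -/
theorem exists_sub_algebraMap_pos (hL : Module.finrank K L = p) (hπL : π ∈ L)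
    (hπ : ramVal p 𝒪 Ks π = (1 : ℚ)) {y : Ks} (hy : y ∈ L) (hy0 : 0 ≤ ramVal p 𝒪 Ks y) :
    ∃ e : 𝒪, 0 < ramVal p 𝒪 Ks (y - algebraMap K Ks e) := by
  obtain ⟨a, hya, ha⟩ := exists_expansion p 𝒪 hL hπL hπ hy
  have h0 := hy0.trans (ha 0 hp.out.pos)
  rw [pow_zero, mul_one, ramVal_nonneg_iff] at h0
  refine ⟨⟨a 0, h0⟩, ?_⟩
  rw [hya, ← Finset.add_sum_erase _ _ (Finset.mem_range.mpr hp.out.pos), pow_zero, mul_one,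
    add_sub_cancel_left]
  refine AddValuation.map_lt_sum _ (by simp) fun i hi => ?_
  rw [Finset.mem_erase, Finset.mem_range] at hi
  refine lt_of_le_of_ne (hy0.trans (ha i hi.2)) fun h => hi.1 ?_
  have h1 : ramVal p 𝒪 Ks (algebraMap K Ks 1 * π ^ 0) =
      ramVal p 𝒪 Ks (algebraMap K Ks (a i) * π ^ i) := by
    rw [← h]; simp
  exact (ramVal_term_injective p 𝒪 hπ one_ne_zero hp.out.pos hi.2 h1).symm

/-- The leading term of `g π / π - 1` does not depend on the prime element `π` of `L`. -/
theorem close_conj_div_sub_one (hL : Module.finrank K L = p) (hπL : π ∈ L)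
    (hπ : ramVal p 𝒪 Ks π = (1 : ℚ)) {y : Ks} (hy : y ∈ L) (hy1 : ramVal p 𝒪 Ks y = (1 : ℚ))
    (g : Ks ≃ₐ[K] Ks) (hg0 : g π ≠ π) (hg : 0 < ramVal p 𝒪 Ks (g π / π - 1)) :
    Close (ramVal p 𝒪 Ks) (g y / y - 1) (g π / π - 1) := by
  have hπ0 : π ≠ 0 := by rintro rfl; simp at hπ
  have hy0 : y ≠ 0 := by rintro rfl; simp at hy1
  obtain ⟨a, hya, ha⟩ := exists_expansion p 𝒪 hL hπL hπ hy
  set v := ramVal p 𝒪 Ks with hv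
  set ε := g π / π - 1 with hε
  have hε0 : ε ≠ 0 := by
    rw [hε, sub_ne_zero, Ne, div_eq_one_iff_eq hπ0]
    exact hg0
  have hgπ : g π = π * (1 + ε) := by rw [hε]; field_simp; ring
  choose d hd hd' using fun i => one_add_pow_eq hg.le i
  set c : ℕ → Ks := fun i => algebraMap K Ks (a i) * π ^ i with hc
  have hdiv (i : ℕ) (hi : i < p) : 0 ≤ v (c i / y) := by
    have h1 := ha i hi
    have h2 : v (c i) = v (c i / y) + v y := by rw [← v.map_mul, div_mul_cancel₀ _ hy0]
    change v y ≤ v (c i) at h1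
    rw [h2, hy1] at h1
    generalize v (c i / y) = s at h1
    induction s with
    | top => simp
    | coe s =>
      rw [← WithTop.coe_add, WithTop.coe_le_coe] at h1
      rw [← WithTop.coe_zero, WithTop.coe_le_coe]
      linarith
  have hdiv' (i : ℕ) (hi : i < p) (hi1 : i ≠ 1) : 0 < v (c i / y) := by
    refine lt_of_le_of_ne (hdiv i hi) fun h => hi1 ?_
    have h1 : v (c i) = v y := by
      rw [← div_mul_cancel₀ (c i) hy0, v.map_mul, ← h, zero_add]
    have h2 : v (algebraMap K Ks 1 * π ^ 1) = v (algebraMap K Ks (a i) * π ^ i) := by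
      change _ = v (c i)
      rw [h1, hy1, ← hπ]; simp
    exact (ramVal_term_injective p 𝒪 hπ one_ne_zero hp.out.one_lt hi h2).symm
  have hgy : g y / y - 1 = ε * ∑ i ∈ Finset.range p, c i / y * (i + ε * d i) := by
    have h1 : g y = ∑ i ∈ Finset.range p, c i * (1 + ε) ^ i := by
      conv_lhs => rw [hya]
      rw [map_sum]
      refine Finset.sum_congr rfl fun i _ => ?_
      rw [map_mul, map_pow, AlgEquiv.commutes, hgπ, mul_pow, ← mul_assoc]
    have h2 : g y / y - 1 = (g y - y) / y := by field_simp
    rw [h2, h1]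
    nth_rewrite 1 [hya]
    rw [← Finset.sum_sub_distrib, Finset.sum_div, Finset.mul_sum]
    refine Finset.sum_congr rfl fun i _ => ?_
    change (c i * (1 + ε) ^ i - c i) / y = _
    rw [hd']
    ring
  -- With 1 expanded in this way the comparison is termwise: for i = 1 the difference is a multiple
  -- of ε, and for i ≠ 1 the factor c i / y already has positive valuation.
  have h1 : (1 : Ks) = ∑ i ∈ Finset.range p, c i / y := by
    rw [← Finset.sum_div]
    change 1 = (∑ i ∈ Finset.range p, algebraMap K Ks (a i) * π ^ i) / y
    rw [← hya, div_self hy0]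
  rw [Close, hgy, mul_div_cancel_left₀ _ hε0]
  rw [h1]
  rw [← Finset.sum_sub_distrib]
  refine v.map_lt_sum (by simp) fun i hi => ?_
  rw [Finset.mem_range] at hi
  rw [← mul_sub_one]
  by_cases hi1 : i = 1
  · subst hi1
    have : (((1 : ℕ) : Ks) + ε * d 1 - 1) = ε * d 1 := by push_cast; ring
    rw [this, mul_comm]
    exact val_mul_pos (val_mul_pos hg (hd 1)) (hdiv 1 hi)
  · exact val_mul_pos (hdiv' i hi hi1) (v.map_le_sub (v.map_le_add (val_natCast_nonneg i)
      (val_mul_nonneg hg.le (hd i))) (by simp))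

/-- Krasner's lemma. -/
theorem mem_of_close [IsGalois K Ks] {ρ y : Ks} (hy : y ∈ L) {B : WithTop ℚ}
    (hρ : ∀ g : Ks ≃ₐ[K] Ks, g ρ ≠ ρ → ramVal p 𝒪 Ks (g ρ - ρ) ≤ B)
    (h : B < ramVal p 𝒪 Ks (ρ - y)) : ρ ∈ L := by
  rw [← InfiniteGalois.fixedField_fixingSubgroup L]
  rintro ⟨g, hg⟩
  change g ρ = ρ
  by_contra h1
  refine (hρ g h1).not_gt ?_
  have h2 : g y = y := (IntermediateField.mem_fixingSubgroup_iff _ _).mp hg y hy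
  have h3 : g ρ - ρ = g (ρ - y) - (ρ - y) := by rw [map_sub, h2]; ring
  rw [h3]
  have h4 := AddValuation.map_sub (ramVal p 𝒪 Ks) (g (ρ - y)) (ρ - y)
  rw [ramVal_algEquiv, min_self] at h4
  exact h.trans_le h4

theorem exists_conj_ne [IsGalois K Ks] (hL : Module.finrank K L = p) (hπL : π ∈ L)
    (hπ : ramVal p 𝒪 Ks π = (1 : ℚ)) : ∃ g : Ks ≃ₐ[K] Ks, g π ≠ π := by
  by_contra! h
  have h1 := (InfiniteGalois.mem_bot_iff_fixed (k := K) π).mpr h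
  have h2 := adjoin_eq_of_finrank p 𝒪 hL hπL hπ
  rw [IntermediateField.adjoin_simple_eq_bot_iff.mpr h1] at h2
  rw [← h2, IntermediateField.finrank_bot] at hL
  exact hp.out.ne_one hL.symm

end RamVal

theorem val_pow_coe {F : Type*} [Field F] {v : AddValuation F (WithTop ℚ)} {x : F} {r : ℚ}
    (h : v x = r) (n : ℕ) : v (x ^ n) = ((n * r : ℚ) : WithTop ℚ) := by
  rw [v.map_pow, h, ← WithTop.coe_nsmul, nsmul_eq_mul]

/-! ### Roots of a trinomial: degree, leading terms and break -/

section Trinomial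

variable {K : Type*} [Field K] (p : ℕ) [hp : Fact p.Prime] [CharP K p]
  (𝒪 : ValuationSubring K) [IsDiscreteValuationRing 𝒪] [IsAdicComplete (maximalIdeal 𝒪) 𝒪]
  {Ks : Type*} [Field Ks] [Algebra K Ks] [Algebra.IsAlgebraic K Ks]
  {t w : 𝒪} {m l : ℕ} {π : Ks}

section Root

variable (ht : Irreducible t) (hw : IsUnit w) (hm : 1 ≤ m) (hl : 1 ≤ l) (hlp : l < p)
  (hπ : π ^ p = algebraMap K Ks w * algebraMap K Ks t ^ m * π ^ l + algebraMap K Ks t)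

include ht hw hm hl hlp hπ

omit [CharP K p] in
-- Newton polygon argument: if v π < 1, both terms on the right have valuation above v(π^p); if v π
-- > 1, the term t dominates and forces p · v π = p.
theorem ramVal_root : ramVal p 𝒪 Ks π = (1 : ℚ) := by
  set v := ramVal p 𝒪 Ks
  have hvt : v (algebraMap K Ks t) = (p : ℚ) := (ramVal_eq_prime_iff p 𝒪 t).mpr ht
  have hvw : v (algebraMap K Ks w) = 0 := ramVal_eq_zero_of_isUnit p 𝒪 hw
  have hπ0 : π ≠ 0 := by
    rintro rfl
    rw [zero_pow hp.out.ne_zero, zero_pow (by omega), mul_zero, zero_add] at hπ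
    rw [← hπ, v.map_zero] at hvt
    exact WithTop.top_ne_coe hvt
  obtain ⟨r, hr⟩ := exists_val_eq (v := v) hπ0
  have h1 := val_pow_coe hr p
  have h2 : v (algebraMap K Ks w * algebraMap K Ks t ^ m * π ^ l) =
      ((m * p + l * r : ℚ) : WithTop ℚ) := by
    rw [v.map_mul, v.map_mul, hvw, val_pow_coe hvt, val_pow_coe hr, zero_add, WithTop.coe_add]
  have hp0 : (0 : ℚ) < p := by exact_mod_cast hp.out.pos
  have hlp' : (l : ℚ) + 1 ≤ p := by exact_mod_cast hlp
  have hl' : (1 : ℚ) ≤ l := by exact_mod_cast hl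
  have hmp : (p : ℚ) ≤ m * p := le_mul_of_one_le_left hp0.le (by exact_mod_cast hm)
  rcases lt_trichotomy r 1 with h | h | h
  · exfalso
    have : v (π ^ p) < v (π ^ p) := by
      conv_rhs => rw [hπ]
      refine v.map_lt_add ?_ ?_
      · rw [h1, h2, WithTop.coe_lt_coe]
        nlinarith
      · rw [h1, hvt, WithTop.coe_lt_coe]
        nlinarith
    exact lt_irrefl _ this
  · rw [hr, h]
  · exfalso
    have h3 : v (π ^ p) = (p : ℚ) := by
      rw [hπ, v.map_add_eq_of_lt_right, hvt]
      rw [h2, hvt, WithTop.coe_lt_coe]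
      nlinarith
    rw [h1, WithTop.coe_inj] at h3
    nlinarith

omit [CharP K p] in
theorem close_root_pow : Close (ramVal p 𝒪 Ks) (π ^ p) (algebraMap K Ks t) := by
  have h1 := ramVal_root p 𝒪 ht hw hm hl hlp hπ
  have hvt : ramVal p 𝒪 Ks (algebraMap K Ks t) = (p : ℚ) := (ramVal_eq_prime_iff p 𝒪 t).mpr ht
  have hvw : ramVal p 𝒪 Ks (algebraMap K Ks w) = 0 := ramVal_eq_zero_of_isUnit p 𝒪 hw
  have hp0 : (0 : ℚ) < p := by exact_mod_cast hp.out.pos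
  have hl' : (1 : ℚ) ≤ l := by exact_mod_cast hl
  have hmp : (p : ℚ) ≤ m * p := le_mul_of_one_le_left hp0.le (by exact_mod_cast hm)
  apply Close.of_lt
  rw [hπ, add_sub_cancel_right, AddValuation.map_mul, AddValuation.map_mul, hvw, val_pow_coe hvt,
    val_pow_coe h1, hvt, zero_add, ← WithTop.coe_add, WithTop.coe_lt_coe]
  linarith

omit [CharP K p] in
-- The valuation 1 of π makes the degree a multiple of p, and the trinomial bounds it by p.
theorem finrank_adjoin_root : Module.finrank K K⟮π⟯ = p := by
  have hi : IsIntegral K π := Algebra.IsIntegral.isIntegral π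
  have hd := dvd_finrank_adjoin p 𝒪 (ramVal_root p 𝒪 ht hw hm hl hlp hπ)
  refine Nat.le_antisymm ?_ (Nat.le_of_dvd ?_ hd)
  · rw [IntermediateField.adjoin.finrank hi]
    have h : (C ((w : K) * (t : K) ^ m) * X ^ l + C (t : K) : K[X]).natDegree ≤ l := by
      compute_degree
    have hmon : (X ^ p - (C ((w : K) * (t : K) ^ m) * X ^ l + C (t : K)) : K[X]).Monic :=
      monic_X_pow_sub (degree_le_natDegree.trans_lt (by exact_mod_cast h.trans_lt hlp))
    have hdeg : (X ^ p - (C ((w : K) * (t : K) ^ m) * X ^ l + C (t : K)) : K[X]).natDegree = p := by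
      rw [natDegree_sub_eq_left_of_natDegree_lt] <;> rw [natDegree_X_pow]
      omega
    rw [← hdeg]
    apply natDegree_le_natDegree
    apply minpoly.min K π hmon
    simp [hπ]
  · rw [IntermediateField.adjoin.finrank hi]
    exact minpoly.natDegree_pos hi

/-- The leading term of `(ρ / π - 1) ^ (p - 1)` for two distinct roots `π`, `ρ`. -/
theorem close_root_div_pow {n : ℕ} (hn : n + p = m * p + l) {ρ : Ks}
    (hρ : ρ ^ p = algebraMap K Ks w * algebraMap K Ks t ^ m * ρ ^ l + algebraMap K Ks t)
    (hne : ρ ≠ π) : 0 < ramVal p 𝒪 Ks (ρ / π - 1) ∧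
      Close (ramVal p 𝒪 Ks) ((ρ / π - 1) ^ (p - 1)) (l * algebraMap K Ks w * π ^ n) := by
  have hvt : ramVal p 𝒪 Ks (algebraMap K Ks t) = (p : ℚ) := (ramVal_eq_prime_iff p 𝒪 t).mpr ht
  have hvw : ramVal p 𝒪 Ks (algebraMap K Ks w) = 0 := ramVal_eq_zero_of_isUnit p 𝒪 hw
  have hvπ := ramVal_root p 𝒪 ht hw hm hl hlp hπ
  have hvρ := ramVal_root p 𝒪 ht hw hm hl hlp hρ
  have hcl := close_root_pow p 𝒪 ht hw hm hl hlp hπ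
  have hp0 : (0 : ℚ) < p := by exact_mod_cast hp.out.pos
  have hl' : (1 : ℚ) ≤ l := by exact_mod_cast hl
  have hmp : (p : ℚ) ≤ m * p := le_mul_of_one_le_left hp0.le (by exact_mod_cast hm)
  have : CharP Ks p := charP_of_injective_algebraMap (algebraMap K Ks).injective p
  set v := ramVal p 𝒪 Ks with hv
  have hπ0 : π ≠ 0 := by rintro rfl; simp at hvπ
  have ht0 : algebraMap K Ks t ≠ 0 := hcl.ne_right
  have hw0 : algebraMap K Ks w ≠ 0 := by
    rw [← v.ne_top_iff, hvw]; simp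
  set T := algebraMap K Ks t
  set W := algebraMap K Ks w
  set a : ℕ → Ks := fun i => (if i = 0 then T else 0) + (if i = l then W * T ^ m else 0) with ha
  have hsum (x : Ks) : ∑ i ∈ Finset.range p, a i * x ^ i = W * T ^ m * x ^ l + T := by
    simp only [ha, add_mul, ite_mul, zero_mul, Finset.sum_add_distrib, Finset.sum_ite_eq',
      Finset.mem_range, hp.out.pos, hlp, if_true]
    ring
  have hal : a l = W * T ^ m := by
    simp only [ha, if_true, if_neg (show l ≠ 0 by omega), zero_add]
  have hρ' : π * (1 + (ρ / π - 1)) = ρ := by field_simp; ring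
  have hvl : v (a l * π ^ l) = ((m * p + l : ℚ) : WithTop ℚ) := by
    rw [hal, v.map_mul, v.map_mul, hvw, val_pow_coe hvt, val_pow_coe hvπ, zero_add, mul_one,
      ← WithTop.coe_add]
  obtain ⟨h1, h2⟩ := close_pow_of_roots (v := v) p (x := π) (ε := ρ / π - 1) a (l := l) hπ0
    (by rwa [sub_ne_zero, Ne, div_eq_one_iff_eq hπ0])
    (by
      refine v.map_le_sub ?_ (by simp)
      rw [v.map_div, hvρ, hvπ, LinearOrderedAddCommGroupWithTop.sub_self_eq_zero_of_ne_top]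
      simp)
    (by rw [hsum, hπ]) (by rw [hρ', hsum, hρ]) hl hlp
    (by rw [hal]; exact mul_ne_zero hw0 (pow_ne_zero _ ht0))
    (by
      rw [hvl, val_pow_coe hvπ, WithTop.coe_lt_coe]
      linarith)
    (fun i hi1 _ hil => by
      have : a i = 0 := by
        simp only [ha, if_neg hil, if_neg (show i ≠ 0 by omega), zero_add]
      rw [this, zero_mul, v.map_zero, hvl]
      exact WithTop.coe_lt_top _)
  refine ⟨h1, h2.trans ?_⟩
  rw [hal]
  have hl0 : (l : Ks) ≠ 0 := by
    rw [Ne, CharP.cast_eq_zero_iff Ks p]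
    intro h
    have := Nat.le_of_dvd (by omega) h
    omega
  -- Here t^m is replaced by π^(pm); the exponent of π becomes pm + l - p = n.
  have h3 := ((Close.refl (v := v) (mul_ne_zero hl0 hw0)).mul (hcl.symm.pow m)).mul
    (Close.refl (v := v) (x := π ^ l / π ^ p) (by positivity))
  convert h3 using 1
  · field_simp
  · have h4 : π ^ (p * m) * π ^ l = π ^ n * π ^ p := by
      rw [← pow_add, ← pow_add, mul_comm p m, hn]
    rw [← pow_mul, mul_div_assoc', mul_assoc (_ * _) (π ^ (p * m)), h4]
    field_simp

/-- Valuations in `close_root_div_pow` give (p-1) v(ρ/π - 1) = n = (p-1)b. -/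
theorem ramVal_root_sub {n : ℕ} (hn : n + p = m * p + l) {b : ℚ} (hb : ((p : ℚ) - 1) * b = n)
    {ρ : Ks}
    (hρ : ρ ^ p = algebraMap K Ks w * algebraMap K Ks t ^ m * ρ ^ l + algebraMap K Ks t)
    (hne : ρ ≠ π) : ramVal p 𝒪 Ks (ρ / π - 1) = b ∧
      ramVal p 𝒪 Ks (ρ - π) = ((b + 1 : ℚ) : WithTop ℚ) := by
  have hvw : ramVal p 𝒪 Ks (algebraMap K Ks w) = 0 := ramVal_eq_zero_of_isUnit p 𝒪 hw
  have hvπ := ramVal_root p 𝒪 ht hw hm hl hlp hπ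
  have hπ0 : π ≠ 0 := by rintro rfl; simp at hvπ
  have : CharP Ks p := charP_of_injective_algebraMap (algebraMap K Ks).injective p
  have hvl : ramVal p 𝒪 Ks (l : Ks) = 0 := val_natCast p (fun h => by
    have := Nat.le_of_dvd (by omega) h
    omega)
  have hε0 : ρ / π - 1 ≠ 0 := by rwa [sub_ne_zero, Ne, div_eq_one_iff_eq hπ0]
  obtain ⟨r, hr⟩ := exists_val_eq (v := ramVal p 𝒪 Ks) hε0
  have h1 := (close_root_div_pow p 𝒪 ht hw hm hl hlp hπ hn hρ hne).2.val_eq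
  rw [val_pow_coe hr, AddValuation.map_mul, AddValuation.map_mul, hvl, hvw, val_pow_coe hvπ,
    zero_add, zero_add, mul_one, WithTop.coe_inj, Nat.cast_sub hp.out.one_le, Nat.cast_one,
    ← hb] at h1
  have hp1 : (p : ℚ) - 1 ≠ 0 := by
    have : (1 : ℚ) < p := by exact_mod_cast hp.out.one_lt
    linarith
  have h2 := mul_left_cancel₀ hp1 h1
  subst h2
  refine ⟨hr, ?_⟩
  have h3 : ρ - π = (ρ / π - 1) * π := by field_simp
  rw [h3, AddValuation.map_mul, hr, hvπ, WithTop.coe_add]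

theorem root_mem_extensionsWithBreak [IsGalois K Ks] {n : ℕ} (hn : n + p = m * p + l) {b : ℚ}
    (hb : ((p : ℚ) - 1) * b = n) : K⟮π⟯ ∈ extensionsWithBreak Ks 𝒪 p b := by
  have hvπ := ramVal_root p 𝒪 ht hw hm hl hlp hπ
  have hfin := finrank_adjoin_root p 𝒪 ht hw hm hl hlp hπ
  have hmem := IntermediateField.mem_adjoin_simple_self K π
  obtain ⟨g, hg⟩ := exists_conj_ne p 𝒪 hfin hmem hvπ
  refine ⟨hfin, isTotallyRamified_of_finrank p 𝒪 hfin hmem hvπ,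
    (g : Ks →ₐ[K] Ks).comp K⟮π⟯.val, ?_, ⟨π, hmem⟩, ?_, ?_⟩
  · intro h
    exact hg (DFunLike.congr_fun h (⟨π, hmem⟩ : K⟮π⟯))
  · rw [ordOf_eq_ramVal p 𝒪 hfin]
    exact hvπ
  · rw [ordOf_eq_ramVal p 𝒪 hfin]
    refine (ramVal_root_sub p 𝒪 ht hw hm hl hlp hπ hn hb (ρ := g π) ?_ hg).2
    have := congrArg g hπ
    simpa using this

end Root

end Trinomial

/-! ### The coefficient field and substitutions of the prime element -/

section Teichmuller

variable {K : Type*} [Field K] (p : ℕ) [hp : Fact p.Prime] [CharP K p] (𝒪 : ValuationSubring K)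
  [IsAdicComplete (maximalIdeal 𝒪) 𝒪] [PerfectField (ResidueField 𝒪)]

theorem residue_teichmuller (a : ResidueField 𝒪) : residue 𝒪 (teichmuller p 𝒪 a) = a := by
  have : CharP (𝒪 ⧸ maximalIdeal 𝒪) p := charP_residueField p 𝒪
  exact Perfection.mk_teichmuller _

/-- Extract p^n-th roots of a and b in the perfect field k. The defect of additivity is then the
p^n-th power of an element of the maximal ideal, hence lies in its n-th power, for every n. -/
theorem teichmuller_add (a b : ResidueField 𝒪) :
    teichmuller p 𝒪 (a + b) = teichmuller p 𝒪 a + teichmuller p 𝒪 b := by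
  have h1 : CharP (ResidueField 𝒪) p := charP_residueField p 𝒪
  have h2 : PerfectRing (ResidueField 𝒪) p := PerfectField.toPerfectRing p
  have h3 : CharP 𝒪 p := ⟨fun x => by
    rw [← CharP.cast_eq_zero_iff K p x, ← ZeroMemClass.coe_eq_zero]; simp⟩
  have h4 : ExpChar 𝒪 p := ExpChar.prime hp.out
  have h5 : ExpChar (ResidueField 𝒪) p := ExpChar.prime hp.out
  rw [← sub_eq_zero]
  apply IsHausdorff.haus (I := maximalIdeal 𝒪) inferInstance
  intro n
  rw [smul_eq_mul, Ideal.mul_top, SModEq.sub_mem, sub_zero]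
  obtain ⟨a, rfl⟩ := (iterateFrobeniusEquiv (ResidueField 𝒪) p n).surjective a
  obtain ⟨b, rfl⟩ := (iterateFrobeniusEquiv (ResidueField 𝒪) p n).surjective b
  rw [← map_add (iterateFrobeniusEquiv (ResidueField 𝒪) p n)]
  simp only [iterateFrobeniusEquiv_def, map_pow]
  rw [← add_pow_expChar_pow, ← sub_pow_expChar_pow]
  refine Ideal.pow_le_pow_right (Nat.lt_pow_self hp.out.one_lt).le (Ideal.pow_mem_pow ?_ _)
  rw [← residue_eq_zero_iff, map_sub, map_add (residue 𝒪)]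
  simp only [residue_teichmuller, sub_self]

/-- The Teichmüller lift as a ring homomorphism. -/
noncomputable def teichmullerHom : ResidueField 𝒪 →+* 𝒪 :=
  RingHom.mk' (teichmuller p 𝒪) (teichmuller_add p 𝒪)

theorem teichmullerHom_apply (a : ResidueField 𝒪) :
    teichmullerHom p 𝒪 a = teichmuller p 𝒪 a := rfl

theorem residue_comp_teichmullerHom :
    (residue 𝒪).comp (teichmullerHom p 𝒪) = RingHom.id _ :=
  RingHom.ext (residue_teichmuller p 𝒪)

theorem isUnit_teichmuller (a : (ResidueField 𝒪)ˣ) : IsUnit (teichmuller p 𝒪 a) :=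
  a.isUnit.map _

variable [IsDiscreteValuationRing 𝒪] {t t' : 𝒪}

omit [IsAdicComplete (maximalIdeal 𝒪) 𝒪] [PerfectField (ResidueField 𝒪)] in
theorem mem_pow_maximalIdeal_iff_dvd (ht : Irreducible t) (n : ℕ) (x : 𝒪) :
    x ∈ maximalIdeal 𝒪 ^ n ↔ t ^ n ∣ x := by
  rw [ht.maximalIdeal_eq, Ideal.span_singleton_pow, Ideal.mem_span_singleton]

theorem exists_sub_eval_mem (ht : Irreducible t) (x : 𝒪) (n : ℕ) :
    ∃ P : (ResidueField 𝒪)[X], x - P.eval₂ (teichmullerHom p 𝒪) t ∈ maximalIdeal 𝒪 ^ n := by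
  induction n with
  | zero => exact ⟨0, by simp⟩
  | succ n ih =>
    obtain ⟨P, hP⟩ := ih
    rw [mem_pow_maximalIdeal_iff_dvd 𝒪 ht] at hP
    obtain ⟨y, hy⟩ := hP
    refine ⟨P + C (residue 𝒪 y) * X ^ n, ?_⟩
    have h1 : y - teichmullerHom p 𝒪 (residue 𝒪 y) ∈ maximalIdeal 𝒪 := by
      rw [← residue_eq_zero_iff, map_sub, teichmullerHom_apply, residue_teichmuller, sub_self]
    rw [ht.maximalIdeal_eq, Ideal.mem_span_singleton] at h1
    obtain ⟨z, hz⟩ := h1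
    rw [mem_pow_maximalIdeal_iff_dvd 𝒪 ht]
    refine ⟨z, ?_⟩
    rw [eval₂_add, eval₂_mul, eval₂_C, eval₂_pow, eval₂_X, ← sub_sub, hy, pow_succ, mul_assoc, ← hz]
    ring

/-- The t-adic order of P(t) is the X-adic order of P. It does not depend on the prime t, which
makes the substitution t ↦ t' well defined modulo each power of the maximal ideal. -/
theorem eval_mem_pow_iff (ht : Irreducible t) (P : (ResidueField 𝒪)[X]) (n : ℕ) :
    P.eval₂ (teichmullerHom p 𝒪) t ∈ maximalIdeal 𝒪 ^ n ↔ X ^ n ∣ P := by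
  rw [mem_pow_maximalIdeal_iff_dvd 𝒪 ht]
  constructor
  · induction n with
    | zero => simp
    | succ n ih =>
      intro h
      obtain ⟨Q, rfl⟩ := ih ((pow_dvd_pow t n.le_succ).trans h)
      rw [eval₂_mul, eval₂_pow, eval₂_X, pow_succ,
        mul_dvd_mul_iff_left (pow_ne_zero _ ht.ne_zero)] at h
      rw [pow_succ, mul_dvd_mul_iff_left (pow_ne_zero _ X_ne_zero), X_dvd_iff]
      have h1 : residue 𝒪 t = 0 := by
        rw [residue_eq_zero_iff, ht.maximalIdeal_eq]
        exact Ideal.mem_span_singleton_self t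
      have h2 : residue 𝒪 (Q.eval₂ (teichmullerHom p 𝒪) t) = 0 := by
        rw [residue_eq_zero_iff, ht.maximalIdeal_eq]
        exact Ideal.mem_span_singleton.mpr h
      rwa [hom_eval₂, residue_comp_teichmullerHom, h1, eval₂_at_zero, RingHom.id_apply] at h2
  · rintro ⟨Q, rfl⟩
    rw [eval₂_mul, eval₂_pow, eval₂_X]
    exact dvd_mul_right _ _

/-- The ring endomorphism of `𝒪` over `k` that carries one prime element to another. -/
theorem exists_ringHom_map_prime (ht : Irreducible t) (ht' : Irreducible t') :
    ∃ φ : 𝒪 →+* 𝒪, φ t = t' ∧ ∀ a, φ (teichmuller p 𝒪 a) = teichmuller p 𝒪 a := by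
  let m := maximalIdeal 𝒪
  -- Evaluation of polynomials over k at u modulo m^n. At t it is surjective with kernel contained
  -- in that at t', so t ↦ t' descends to 𝒪/m^n; completeness glues the levels.
  let s (u : 𝒪) (n : ℕ) : (ResidueField 𝒪)[X] →+* 𝒪 ⧸ m ^ n :=
    (Ideal.Quotient.mk (m ^ n)).comp (eval₂RingHom (teichmullerHom p 𝒪) u)
  have hs (n : ℕ) : Function.Surjective (s t n) := by
    intro y
    obtain ⟨x, rfl⟩ := Ideal.Quotient.mk_surjective y
    obtain ⟨P, hP⟩ := exists_sub_eval_mem p 𝒪 ht x n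
    exact ⟨P, ((Ideal.Quotient.mk_eq_mk_iff_sub_mem _ _).mpr hP).symm⟩
  have hker (n : ℕ) : RingHom.ker (s t n) ≤ RingHom.ker (s t' n) := by
    intro P hP
    rw [RingHom.mem_ker] at hP ⊢
    have h1 := Ideal.Quotient.eq_zero_iff_mem.mp hP
    exact Ideal.Quotient.eq_zero_iff_mem.mpr
      ((eval_mem_pow_iff p 𝒪 ht' P n).mpr ((eval_mem_pow_iff p 𝒪 ht P n).mp h1))
  let f (n : ℕ) : 𝒪 →+* 𝒪 ⧸ m ^ n :=
    ((s t n).liftOfSurjective (hs n) ⟨s t' n, hker n⟩).comp (Ideal.Quotient.mk (m ^ n))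
  have hf (n : ℕ) (P : (ResidueField 𝒪)[X]) : f n (P.eval₂ (teichmullerHom p 𝒪) t) =
      Ideal.Quotient.mk (m ^ n) (P.eval₂ (teichmullerHom p 𝒪) t') :=
    (s t n).liftOfSurjective_comp_apply (hs n) ⟨s t' n, hker n⟩ P
  have hf0 (n : ℕ) (x y : 𝒪) (h : x - y ∈ m ^ n) : f n x = f n y := by
    exact congrArg ((s t n).liftOfSurjective (hs n) ⟨s t' n, hker n⟩) (Ideal.Quotient.eq.mpr h)
  have hcompat {a b : ℕ} (hab : a ≤ b) : (Ideal.Quotient.factorPow m hab).comp (f b) = f a := by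
    ext x
    obtain ⟨P, hP⟩ := exists_sub_eval_mem p 𝒪 ht x b
    rw [RingHom.comp_apply, hf0 b _ _ hP, hf0 a _ _ (Ideal.pow_le_pow_right hab hP), hf, hf]
    rfl
  let φ : 𝒪 →+* 𝒪 := IsAdicComplete.liftRingHom m f hcompat
  have hφ (P : (ResidueField 𝒪)[X]) :
      φ (P.eval₂ (teichmullerHom p 𝒪) t) = P.eval₂ (teichmullerHom p 𝒪) t' := by
    rw [← sub_eq_zero]
    apply IsHausdorff.haus (I := maximalIdeal 𝒪) inferInstance
    intro n
    rw [smul_eq_mul, Ideal.mul_top, SModEq.sub_mem, sub_zero,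
      ← Ideal.Quotient.mk_eq_mk_iff_sub_mem, ← hf]
    exact IsAdicComplete.mk_liftRingHom m f hcompat n _
  refine ⟨φ, ?_, fun a => ?_⟩
  · simpa using hφ X
  · simpa using! hφ (C a)

/-- Polynomials in t over k are fixed and dense, and φ preserves the powers of the maximal ideal.
This shows that the substitutions t ↦ t' and t' ↦ t are inverse to each other. -/
theorem ringHom_eq_id (ht : Irreducible t) {φ : 𝒪 →+* 𝒪} (hφt : φ t = t)
    (hφ : ∀ a, φ (teichmuller p 𝒪 a) = teichmuller p 𝒪 a) : φ = RingHom.id 𝒪 := by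
  ext1 x
  rw [RingHom.id_apply, ← sub_eq_zero]
  apply IsHausdorff.haus (I := maximalIdeal 𝒪) inferInstance
  intro n
  rw [smul_eq_mul, Ideal.mul_top, SModEq.sub_mem, sub_zero]
  obtain ⟨P, hP⟩ := exists_sub_eval_mem p 𝒪 ht x n
  have h1 : φ (P.eval₂ (teichmullerHom p 𝒪) t) = P.eval₂ (teichmullerHom p 𝒪) t := by
    rw [hom_eval₂, hφt, show φ.comp (teichmullerHom p 𝒪) = teichmullerHom p 𝒪 from RingHom.ext hφ]
  have h2 : φ (x - P.eval₂ (teichmullerHom p 𝒪) t) ∈ maximalIdeal 𝒪 ^ n := by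
    rw [mem_pow_maximalIdeal_iff_dvd 𝒪 ht] at hP ⊢
    have := map_dvd φ hP
    rwa [map_pow, hφt] at this
  rw [map_sub, h1] at h2
  convert sub_mem h2 hP using 1
  ring

/-- There is an automorphism of `K` over `k` that carries one prime element to another. -/
theorem exists_ringEquiv_map_prime (ht : Irreducible t) (ht' : Irreducible t') :
    ∃ φ : K ≃+* K, φ t = t' ∧ FixesResidueField p 𝒪 φ := by
  obtain ⟨φ, h1, h2⟩ := exists_ringHom_map_prime p 𝒪 ht ht'
  obtain ⟨ψ, h3, h4⟩ := exists_ringHom_map_prime p 𝒪 ht' ht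
  let e : 𝒪 ≃+* 𝒪 := RingEquiv.ofRingHom φ ψ
    (ringHom_eq_id p 𝒪 ht' (by simp [h1, h3]) (fun a => by simp [h2, h4]))
    (ringHom_eq_id p 𝒪 ht (by simp [h1, h3]) (fun a => by simp [h2, h4]))
  refine ⟨IsFractionRing.ringEquivOfRingEquiv e, ?_, fun a => ?_⟩
  · have := IsFractionRing.ringEquivOfRingEquiv_algebraMap (K := K) (L := K) e t
    exact this.trans (congrArg (algebraMap 𝒪 K) h1)
  · have := IsFractionRing.ringEquivOfRingEquiv_algebraMap (K := K) (L := K) e (teichmuller p 𝒪 a)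
    exact this.trans (congrArg (algebraMap 𝒪 K) (h2 a))

end Teichmuller

/-! ### Automorphisms of K preserve the valuation ring -/

section Automorphism

variable {K : Type*} [Field K] (p : ℕ) [hp : Fact p.Prime] [CharP K p] (𝒪 : ValuationSubring K)
  [IsAdicComplete (maximalIdeal 𝒪) 𝒪]

/-- Hensel's lemma at 1, where the derivative N is a unit. Being an N-th power is a purely algebraic
property, so it survives automorphisms that are not assumed continuous. -/
theorem exists_pow_eq_one_add {y : 𝒪} (hy : y ∈ maximalIdeal 𝒪) {N : ℕ} (hN : ¬ p ∣ N) :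
    ∃ z : 𝒪, z ^ N = 1 + y := by
  have hN0 : N ≠ 0 := by rintro rfl; simp at hN
  have hc : CharP (ResidueField 𝒪) p := charP_residueField p 𝒪
  obtain ⟨z, hz, -⟩ := HenselianRing.is_henselian (I := maximalIdeal 𝒪)
    (X ^ N - C (1 + y)) (monic_X_pow_sub_C _ hN0) 1 (by simpa using hy) (by
      have h : (Ideal.Quotient.mk (maximalIdeal 𝒪)) (N : 𝒪) ≠ 0 := by
        change residue 𝒪 (N : 𝒪) ≠ 0
        rw [map_natCast, Ne, CharP.cast_eq_zero_iff (ResidueField 𝒪) p]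
        exact hN
      have h2 : eval 1 (derivative (X ^ N - C (1 + y) : 𝒪[X])) = N := by
        rw [derivative_sub, derivative_X_pow, derivative_C]; simp
      rw [h2]
      exact (show residue 𝒪 (N : 𝒪) ≠ 0 from h).isUnit)
  refine ⟨z, ?_⟩
  have : eval z (X ^ N - C (1 + y) : 𝒪[X]) = 0 := hz
  rw [eval_sub, eval_pow, eval_X, eval_C] at this
  exact sub_eq_zero.mp this

variable [IsDiscreteValuationRing 𝒪]

omit [IsAdicComplete (maximalIdeal 𝒪) 𝒪] in
theorem ordBase_pow (x : K) (n : ℕ) : ordBase 𝒪 (x ^ n) = n * ordBase 𝒪 x := by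
  simp [ordBase, WithZero.log_pow]

include p in
/-- Every automorphism of `K` preserves the valuation ring. -/
theorem ringEquiv_mem (φ : K ≃+* K) {x : K} (hx : x ∈ 𝒪) : φ x ∈ 𝒪 := by
  have key (y : 𝒪) (hy : y ∈ maximalIdeal 𝒪) : φ y ∈ 𝒪 := by
    have hy1 : (1 + y : K) ≠ 0 := by
      intro h
      have h1 : IsUnit y := by
        have : y = -1 := Subtype.ext (by push_cast; linear_combination h)
        rw [this]; exact isUnit_one.neg
      exact (mem_maximalIdeal y).mp hy h1
    have h0 : φ (1 + y) ≠ 0 := (map_ne_zero φ).mpr hy1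
    set o := ordBase 𝒪 (φ (1 + y)) with ho
    have h1 : o = 0 := by
      -- The exponent N = p|o| + 1 is prime to p and exceeds |o|; as 1 + y is an N-th power, N
      -- divides o, so o = 0.
      obtain ⟨z, hz⟩ := exists_pow_eq_one_add p 𝒪 hy (N := p * o.natAbs + 1) (by
        intro h
        have := (Nat.dvd_add_right (dvd_mul_right p o.natAbs)).mp h
        exact hp.out.one_lt.ne' (Nat.dvd_one.mp this))
      have hz' : (φ z) ^ (p * o.natAbs + 1) = φ (1 + y) := by
        rw [← map_pow]
        congr 1
        exact_mod_cast congrArg (Subtype.val) hz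
      have hz0 : φ z ≠ 0 := by
        intro h
        rw [h, zero_pow (by omega)] at hz'
        exact h0 hz'.symm
      have h2 := ordBase_pow 𝒪 (φ z) (p * o.natAbs + 1)
      rw [hz', ← ho] at h2
      have h3 : (((p * o.natAbs + 1 : ℕ) : ℤ)) ∣ o := ⟨_, h2⟩
      apply Int.eq_zero_of_abs_lt_dvd h3
      rw [Int.abs_eq_natAbs]
      have := Nat.le_mul_of_pos_left o.natAbs hp.out.pos
      exact_mod_cast Nat.lt_succ_of_le this
    have h2 : φ (1 + y) ∈ 𝒪 := (ordBase_nonneg_iff 𝒪 h0).mp (ho ▸ h1.ge)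
    rw [map_add, map_one] at h2
    simpa using sub_mem h2 (one_mem 𝒪)
  obtain ⟨t, ht⟩ := IsDiscreteValuationRing.exists_irreducible 𝒪
  by_cases hx0 : x = 0
  · simp [hx0]
  have hφx : φ x ≠ 0 := by simpa using hx0
  have hφt : φ t ≠ 0 := by simpa using ht.ne_zero
  rw [← ordBase_nonneg_iff 𝒪 hφx]
  by_contra hneg
  -- M is large enough that φ(x^M t) would have negative order, although x^M t lies in the maximal
  -- ideal.
  set M := (ordBase 𝒪 (φ t)).natAbs + 1 with hM
  have h1 := key (⟨x, hx⟩ ^ M * t) (Ideal.mul_mem_left _ _ ((mem_maximalIdeal t).mpr ht.not_isUnit))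
  push_cast at h1
  rw [map_mul, map_pow, ← ordBase_nonneg_iff 𝒪 (mul_ne_zero (pow_ne_zero _ hφx) hφt),
    ordBase_mul 𝒪 (pow_ne_zero _ hφx) hφt, ordBase_pow 𝒪 (φ x)] at h1
  have h2 : ordBase 𝒪 (φ x) ≤ -1 := by omega
  have h3 : (M : ℤ) * ordBase 𝒪 (φ x) ≤ M * (-1) := mul_le_mul_of_nonneg_left h2 (by positivity)
  have h4 : (M : ℤ) = (ordBase 𝒪 (φ t)).natAbs + 1 := by rw [hM]; push_cast; rfl
  omega

include p in
theorem ringEquiv_map_irreducible (φ : K ≃+* K) {t : 𝒪} (ht : Irreducible t) :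
    ∃ t' : 𝒪, Irreducible t' ∧ (t' : K) = φ t := by
  let e : 𝒪 ≃+* 𝒪 :=
    { toFun := fun x => ⟨φ x, ringEquiv_mem p 𝒪 φ x.2⟩
      invFun := fun x => ⟨φ.symm x, ringEquiv_mem p 𝒪 φ.symm x.2⟩
      left_inv := fun x => Subtype.ext (by simp)
      right_inv := fun x => Subtype.ext (by simp)
      map_mul' := fun x y => Subtype.ext (by simp)
      map_add' := fun x y => Subtype.ext (by simp) }
  exact ⟨e t, (MulEquiv.irreducible_iff e).mpr ht, rfl⟩

end Automorphism

/-! ### Lower bounds for valuations -/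

section Bounds

variable {F : Type*} [Field F] {v : AddValuation F (WithTop ℚ)} {x y : F} {r s : ℚ}

theorem le_val_mul (hx : (r : WithTop ℚ) ≤ v x) (hy : (s : WithTop ℚ) ≤ v y) :
    ((r + s : ℚ) : WithTop ℚ) ≤ v (x * y) := by
  rw [v.map_mul, WithTop.coe_add]
  exact add_le_add hx hy

theorem le_val_pow (hx : (r : WithTop ℚ) ≤ v x) (n : ℕ) :
    ((n * r : ℚ) : WithTop ℚ) ≤ v (x ^ n) := by
  rw [v.map_pow, ← nsmul_eq_mul, WithTop.coe_nsmul]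
  exact nsmul_le_nsmul_right hx n

theorem le_val_mono (h : s ≤ r) (hx : (r : WithTop ℚ) ≤ v x) : (s : WithTop ℚ) ≤ v x :=
  le_trans (WithTop.coe_le_coe.mpr h) hx

/-- `x ^ n - y ^ n` is divisible by `x - y`, with bounds. -/
theorem le_val_pow_sub_pow (hx : (r : WithTop ℚ) ≤ v x) (hy : (r : WithTop ℚ) ≤ v y)
    (hxy : (s : WithTop ℚ) ≤ v (x - y)) (n : ℕ) :
    ((n * r + s : ℚ) : WithTop ℚ) ≤ v (x ^ (n + 1) - y ^ (n + 1)) := by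
  rw [← (Commute.all x y).geom_sum₂_mul]
  refine le_val_mul (v.map_le_sum fun i hi => ?_) hxy
  rw [Finset.mem_range] at hi
  refine le_val_mono (le_of_eq ?_) (le_val_mul (le_val_pow hx i) (le_val_pow hy (n + 1 - 1 - i)))
  rw [← add_mul, ← Nat.cast_add]
  congr 2
  omega

/-- Pigeonhole on the factors. For S the roots of a split monic polynomial, a large valuation of its
value at y yields a root close to y. -/
theorem exists_lt_val_sub (S : Multiset F) {B : ℚ}
    (h : ((Multiset.card S * B : ℚ) : WithTop ℚ) < v (S.map (fun a => y - a)).prod) :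
    ∃ a ∈ S, (B : WithTop ℚ) < v (y - a) := by
  by_contra! hle
  refine h.not_ge ?_
  clear h
  induction S using Multiset.induction with
  | empty => simp
  | cons a S ih =>
    rw [Multiset.map_cons, Multiset.prod_cons, v.map_mul, Multiset.card_cons, Nat.cast_succ,
      add_one_mul, add_comm, WithTop.coe_add]
    exact add_le_add (ih fun b hb => hle b (Multiset.mem_cons_of_mem hb))
      (hle a (Multiset.mem_cons_self a S)) |>.trans' (by rw [add_comm])

end Bounds

/-! ### Improving approximate roots of trinomials -/

section Trinomial

variable {K : Type*} [Field K] (p : ℕ) [hp : Fact p.Prime] [CharP K p]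
  (𝒪 : ValuationSubring K)

/-- The trinomial `X ^ p - w t ^ m X ^ l - t`. -/
noncomputable def trinomial (t w : K) (m l : ℕ) : K[X] := X ^ p - C (w * t ^ m) * X ^ l - C t

omit hp [CharP K p] in
theorem trinomial_natDegree_lt {t w : K} {m l : ℕ} (hlp : l < p) :
    (C (w * t ^ m) * X ^ l + C t).natDegree < p := by
  have h : (C (w * t ^ m) * X ^ l + C t).natDegree ≤ l := by compute_degree
  exact h.trans_lt hlp

omit hp [CharP K p] in
theorem trinomial_monic {t w : K} {m l : ℕ} (hlp : l < p) : (trinomial p t w m l).Monic := by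
  rw [trinomial, sub_sub]
  exact monic_X_pow_sub (degree_le_natDegree.trans_lt
    (Nat.cast_lt.mpr (trinomial_natDegree_lt p hlp)))

omit hp [CharP K p] in
theorem trinomial_natDegree {t w : K} {m l : ℕ} (hlp : l < p) :
    (trinomial p t w m l).natDegree = p := by
  rw [trinomial, sub_sub, natDegree_sub_eq_left_of_natDegree_lt, natDegree_X_pow]
  rw [natDegree_X_pow]
  exact trinomial_natDegree_lt p hlp

/-- The derivative is a unit times X^(l-1), and X is prime to the trinomial since its constant term
is nonzero. Separability is what places all the roots in `Ks`. -/
theorem trinomial_separable {t w : K} {m l : ℕ} (ht : t ≠ 0) (hw : w ≠ 0) (hl : 1 ≤ l)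
    (hlp : l < p) : (trinomial p t w m l).Separable := by
  have hl0 : (l : K) ≠ 0 := by
    rw [Ne, CharP.cast_eq_zero_iff K p]
    intro h
    have := Nat.le_of_dvd (by omega) h
    omega
  have hd : derivative (trinomial p t w m l) = C (-(w * t ^ m * l)) * X ^ (l - 1) := by
    rw [trinomial]
    simp only [derivative_sub, derivative_X_pow, derivative_C_mul, derivative_C, CharP.cast_eq_zero]
    simp only [map_zero, zero_mul, map_natCast, map_neg, map_mul]
    ring
  have hX : IsCoprime (trinomial p t w m l) X := by
    refine ⟨C (-t⁻¹), C t⁻¹ * (X ^ (p - 1) - C (w * t ^ m) * X ^ (l - 1)), ?_⟩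
    have h1 : (X : K[X]) ^ p = X ^ (p - 1) * X := by
      rw [← pow_succ, Nat.sub_add_cancel hp.out.one_le]
    have h2 : (X : K[X]) ^ l = X ^ (l - 1) * X := by rw [← pow_succ, Nat.sub_add_cancel hl]
    have h3 : (C t⁻¹ * C t : K[X]) = 1 := by rw [← C_mul, inv_mul_cancel₀ ht, C_1]
    rw [trinomial, h1, h2, map_neg]
    linear_combination h3
  rw [separable_def, hd]
  refine (isCoprime_mul_unit_left_right (isUnit_C.mpr ?_) _ _).mpr hX.pow_right
  exact (neg_ne_zero.mpr (mul_ne_zero (mul_ne_zero hw (pow_ne_zero _ ht)) hl0)).isUnit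

variable {Ks : Type*} [Field Ks] [Algebra K Ks]

omit hp [CharP K p] in
theorem aeval_trinomial (t w : K) (m l : ℕ) (x : Ks) : aeval x (trinomial p t w m l) =
    x ^ p - algebraMap K Ks w * algebraMap K Ks t ^ m * x ^ l - algebraMap K Ks t := by
  simp [trinomial]

omit hp [CharP K p] in
theorem aeval_trinomial_eq_zero_iff (t w : K) (m l : ℕ) (x : Ks) :
    aeval x (trinomial p t w m l) = 0 ↔
      x ^ p = algebraMap K Ks w * algebraMap K Ks t ^ m * x ^ l + algebraMap K Ks t := by
  rw [aeval_trinomial, sub_sub, sub_eq_zero]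

variable [IsDiscreteValuationRing 𝒪] [IsAdicComplete (maximalIdeal 𝒪) 𝒪] [IsSepClosure K Ks]
  {L : IntermediateField K Ks} {y π : Ks} {m l n : ℕ}

omit [CharP K p] in
theorem exists_ramVal_eq_int (hL : Module.finrank K L = p) (hπL : π ∈ L)
    (hπ : ramVal p 𝒪 Ks π = (1 : ℚ)) (hy : y ∈ L) (hy0 : y ≠ 0) :
    ∃ z : ℤ, ramVal p 𝒪 Ks y = ((z : ℚ) : WithTop ℚ) := by
  have h0 : (p : ℚ) ≠ 0 := by exact_mod_cast hp.out.ne_zero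
  obtain ⟨r, hr⟩ : ∃ r : ℚ, ord 𝒪 y = r := ⟨_, ord_eq_minpoly 𝒪 hy0⟩
  obtain ⟨z, hz⟩ := ((isTotallyRamified_of_finrank p 𝒪 hL hπL hπ).2 r).mp ⟨y, hy, hr⟩
  refine ⟨z, ?_⟩
  rw [(ord_eq_coe_iff p 𝒪 y r).mp hr, hz, hL, mul_div_cancel₀ _ h0]

omit [CharP K p] in
theorem le_ramVal_of_lt (hL : Module.finrank K L = p) (hπL : π ∈ L)
    (hπ : ramVal p 𝒪 Ks π = (1 : ℚ)) (hy : y ∈ L) {k : ℤ}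
    (h : ((k : ℚ) : WithTop ℚ) < ramVal p 𝒪 Ks y) :
    ((k + 1 : ℚ) : WithTop ℚ) ≤ ramVal p 𝒪 Ks y := by
  by_cases hy0 : y = 0
  · simp [hy0]
  obtain ⟨z, hz⟩ := exists_ramVal_eq_int p 𝒪 hL hπL hπ hy hy0
  rw [hz, WithTop.coe_lt_coe] at h
  rw [hz, WithTop.coe_le_coe]
  have : k < z := by exact_mod_cast h
  exact_mod_cast this

/-- An approximate root of a trinomial can be improved, at the cost of changing `t`. -/
theorem exists_improved_approximation (hL : Module.finrank K L = p) {w : 𝒪} (hw : IsUnit w)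
    (hl : 1 ≤ l) (hlp : l < p) (hn : n + p = m * p + l) {s : ℕ}
    (hs : 2 ≤ s) {t : 𝒪} (ht : Irreducible t) (hy : y ∈ L) (hy1 : ramVal p 𝒪 Ks y = (1 : ℚ))
    (happ : ((n + p + s - 1 : ℚ) : WithTop ℚ) ≤
      ramVal p 𝒪 Ks (aeval y (trinomial p (t : K) w m l))) :
    ∃ y' ∈ L, ∃ t' : 𝒪, Irreducible t' ∧ ramVal p 𝒪 Ks y' = (1 : ℚ) ∧
      ((n + p + s : ℚ) : WithTop ℚ) ≤
        ramVal p 𝒪 Ks (aeval y' (trinomial p (t' : K) w m l)) := by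
  obtain ⟨s, rfl⟩ : ∃ k, s = k + 1 := ⟨s - 1, by omega⟩
  have hvt : ramVal p 𝒪 Ks (algebraMap K Ks t) = (p : ℚ) := (ramVal_eq_prime_iff p 𝒪 t).mpr ht
  have hvw : ramVal p 𝒪 Ks (algebraMap K Ks w) = 0 := ramVal_eq_zero_of_isUnit p 𝒪 hw
  have hcp : CharP Ks p := charP_of_injective_algebraMap (algebraMap K Ks).injective p
  have hvl : ramVal p 𝒪 Ks (l : Ks) = 0 := val_natCast p (fun h => by
    have := Nat.le_of_dvd (by omega) h
    omega)
  have hpos := ramVal_nonneg_iff p 𝒪 (Ks := Ks)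
  set v := ramVal p 𝒪 Ks with hv
  set T := algebraMap K Ks t with hT
  set W := algebraMap K Ks w with hW
  set D := aeval y (trinomial p (t : K) w m l) with hD
  have hDdef : D = y ^ p - W * T ^ m * y ^ l - T := aeval_trinomial p _ _ _ _ _
  set N := (l : Ks) * W * T ^ m * y ^ (l + s) with hN
  have hnq : (n + p : ℚ) = m * p + l := by exact_mod_cast hn
  have hvN : v N = ((n + p + s : ℚ) : WithTop ℚ) := by
    rw [hN, v.map_mul, v.map_mul, v.map_mul, hvl, hvw, val_pow_coe hvt, val_pow_coe hy1, zero_add,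
      zero_add, ← WithTop.coe_add]
    congr 1
    push_cast
    linarith
  have hN0 : N ≠ 0 := by rw [← v.ne_top_iff, hvN]; exact WithTop.coe_ne_top
  have hmemN : N ∈ L := by
    refine mul_mem (mul_mem (mul_mem ?_ (L.algebraMap_mem _)) (pow_mem (L.algebraMap_mem _) _))
      (pow_mem hy _)
    exact natCast_mem L l
  have hDL : D ∈ L := by
    rw [hDdef]
    exact sub_mem (sub_mem (pow_mem hy _) (mul_mem (mul_mem (L.algebraMap_mem _)
      (pow_mem (L.algebraMap_mem _) _)) (pow_mem hy _))) (L.algebraMap_mem _)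
  have hDN : 0 ≤ v (D / N) := by
    rw [v.map_div, hvN]
    have h1 : ((n + p + s : ℚ) : WithTop ℚ) ≤ v D := le_val_mono (by push_cast; linarith) happ
    generalize v D = d at h1
    induction d with
    | top => exact le_top
    | coe d => exact_mod_cast sub_nonneg.mpr (WithTop.coe_le_coe.mp h1)
  obtain ⟨e, he⟩ := exists_sub_algebraMap_pos p 𝒪 hL hy hy1 (div_mem hDL hmemN) hDN
  have he1 : ((1 : ℚ) : WithTop ℚ) ≤ v (D / N - algebraMap K Ks e) := by
    have := le_ramVal_of_lt p 𝒪 hL hy hy1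
      (sub_mem (div_mem hDL hmemN) (L.algebraMap_mem (e : K))) (k := 0) (by simpa using he)
    simpa using this
  set E := algebraMap K Ks e with hE
  have hvE : ((0 : ℚ) : WithTop ℚ) ≤ v E := (hpos e).mpr e.2
  have hle {x : Ks} {r : ℚ} (h : v x = r) : (r : WithTop ℚ) ≤ v x := h.ge
  have hle0 {x : Ks} (h : v x = 0) : ((0 : ℚ) : WithTop ℚ) ≤ v x := h.ge
  have hp2 : (2 : ℚ) ≤ p := by exact_mod_cast hp.out.two_le
  have hs1 : (1 : ℚ) ≤ s := by exact_mod_cast (by omega : 1 ≤ s)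
  have hlq : (1 : ℚ) ≤ l := by exact_mod_cast hl
  have hpsq : (2 : ℚ) * s ≤ p * s := by gcongr
  set ε := E * y ^ s with hε
  have hvε : ((s : ℚ) : WithTop ℚ) ≤ v ε :=
    le_val_mono (by linarith) (le_val_mul hvE (le_val_pow (hle hy1) s))
  -- The change of y also adds E^p y^(p(s+1)) to y^p, which may be larger than the error being
  -- removed. Replacing t by t(1 + δ) absorbs it, since y^p is close to t.
  set δ := E ^ p * T ^ s with hδ
  have hvδ : ((p * s : ℚ) : WithTop ℚ) ≤ v δ :=
    le_val_mono (by linarith) (le_val_mul (le_val_pow hvE p) (le_val_pow (hle hvt) s))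
  have hε0 : 0 < v ε := lt_of_lt_of_le (by exact_mod_cast (by omega : 0 < s)) hvε
  have hδ0 : 0 < v δ := lt_of_lt_of_le (by
    have : (0 : ℚ) < p * s := by linarith
    exact_mod_cast this) hvδ
  have h1ε : v (1 + ε) = 0 := val_eq_zero_of_sub_one (by simpa using hε0)
  have h1δ : v (1 + δ) = 0 := val_eq_zero_of_sub_one (by simpa using hδ0)
  have hT' : algebraMap K Ks ((t * (1 + e ^ p * t ^ s) : 𝒪) : K) = T * (1 + δ) := by
    simp [hT, hδ, hE]
  refine ⟨y * (1 + ε), mul_mem hy (add_mem (one_mem L) (mul_mem (L.algebraMap_mem _)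
    (pow_mem hy _))), t * (1 + e ^ p * t ^ s), ?_, ?_, ?_⟩
  · rw [← ramVal_eq_prime_iff p 𝒪 (Ks := Ks), hT', ← hv, v.map_mul, h1δ, hvt, add_zero]
  · rw [v.map_mul, hy1, h1ε, add_zero]
  rw [aeval_trinomial, hT', ← hW]
  obtain ⟨c, hc, hc'⟩ := one_add_pow_eq hε0.le l
  obtain ⟨d, hd, hd'⟩ := one_add_pow_eq hδ0.le m
  have hyp : (y * (1 + ε)) ^ p = y ^ p + E ^ p * (y ^ p) ^ (s + 1) := by
    have : ExpChar Ks p := ExpChar.prime hp.out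
    rw [mul_pow, add_pow_expChar, hε]
    ring
  have key : (y * (1 + ε)) ^ p - W * (T * (1 + δ)) ^ m * (y * (1 + ε)) ^ l - T * (1 + δ) =
      N * (D / N - E) + E ^ p * ((y ^ p) ^ (s + 1) - T ^ (s + 1))
        - W * T ^ m * y ^ l * (1 + ε) ^ l * (δ * (m + δ * d)) - W * T ^ m * y ^ l * (ε ^ 2 * c) := by
    have h1 : N * (D / N - E) = y ^ p - W * T ^ m * y ^ l - T - l * W * T ^ m * y ^ l * ε := by
      rw [mul_sub, mul_div_cancel₀ _ hN0, hDdef, hN, hε]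
      ring
    rw [hyp, h1, mul_pow T, hd', mul_pow y, hc', hδ]
    ring
  rw [key]
  have hyT : ((n + p : ℚ) : WithTop ℚ) ≤ v (y ^ p - T) := by
    have : y ^ p - T = D + W * T ^ m * y ^ l := by rw [hDdef]; ring
    rw [this]
    refine v.map_le_add (le_val_mono (by push_cast; linarith) happ) (le_val_mono ?_
      (le_val_mul (le_val_mul (hle0 hvw) (le_val_pow (hle hvt) m)) (le_val_pow (hle hy1) l)))
    linarith
  have hWTy := le_val_mul (le_val_mul (hle0 hvw) (le_val_pow (hle hvt) m)) (le_val_pow (hle hy1) l)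
  refine v.map_le_sub (v.map_le_sub (v.map_le_add ?_ ?_) ?_) ?_
  · refine le_val_mono ?_ (le_val_mul (hle hvN) he1)
    push_cast
    linarith
  · refine le_val_mono ?_ (le_val_mul (le_val_pow hvE p)
      (le_val_pow_sub_pow (le_val_mono (by linarith) (le_val_pow (hle hy1) p)) (hle hvt) hyT s))
    push_cast
    linarith
  · refine le_val_mono ?_ (le_val_mul (le_val_mul hWTy (le_val_pow (hle0 h1ε) l))
      (le_val_mul hvδ (s := 0) ?_))
    · push_cast
      linarith
    · exact v.map_le_add (val_natCast_nonneg m) (val_mul_nonneg hδ0.le hd)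
  · refine le_val_mono ?_ (le_val_mul hWTy (le_val_mul (le_val_pow hvε 2) (s := 0) hc))
    push_cast
    linarith

theorem exists_approximation (hL : Module.finrank K L = p) {w : 𝒪} (hw : IsUnit w)
    (hl : 1 ≤ l) (hlp : l < p) (hn : n + p = m * p + l)
    {t : 𝒪} (ht : Irreducible t) (hy : y ∈ L) (hy1 : ramVal p 𝒪 Ks y = (1 : ℚ))
    (happ : ((n + p + 1 : ℚ) : WithTop ℚ) ≤
      ramVal p 𝒪 Ks (aeval y (trinomial p (t : K) w m l))) (s : ℕ) (hs : 1 ≤ s) :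
    ∃ y' ∈ L, ∃ t' : 𝒪, Irreducible t' ∧ ramVal p 𝒪 Ks y' = (1 : ℚ) ∧
      ((n + p + s : ℚ) : WithTop ℚ) ≤
        ramVal p 𝒪 Ks (aeval y' (trinomial p (t' : K) w m l)) := by
  induction s, hs using Nat.le_induction with
  | base => exact ⟨y, hy, t, ht, hy1, by exact_mod_cast happ⟩
  | succ s hs ih =>
    obtain ⟨y', hy', t', ht', hy1', happ'⟩ := ih
    refine exists_improved_approximation p 𝒪 hL hw hl hlp hn (s := s + 1) (by omega) ht' hy' hy1'
      (le_val_mono ?_ happ')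
    push_cast
    linarith

/-- A field that contains an approximate root of a trinomial is generated by a root of a trinomial
with the same `w`. -/
theorem exists_root_of_approximation (hL : Module.finrank K L = p) {w : 𝒪} (hw : IsUnit w)
    (hl : 1 ≤ l) (hlp : l < p) (hm : 1 ≤ m) (hn : n + p = m * p + l)
    {t : 𝒪} (ht : Irreducible t) (hy : y ∈ L) (hy1 : ramVal p 𝒪 Ks y = (1 : ℚ))
    (happ : ((n + p + 1 : ℚ) : WithTop ℚ) ≤
      ramVal p 𝒪 Ks (aeval y (trinomial p (t : K) w m l))) :
    ∃ t' : 𝒪, Irreducible t' ∧ ∃ ρ : Ks, aeval ρ (trinomial p (t' : K) w m l) = 0 ∧ K⟮ρ⟯ = L := by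
  have hp1 : (1 : ℚ) < p := by exact_mod_cast hp.out.one_lt
  obtain ⟨b, hb⟩ : ∃ b : ℚ, ((p : ℚ) - 1) * b = n := ⟨n / (p - 1), by
    rw [mul_div_cancel₀]; linarith⟩
  -- Each of the p roots is at valuation b + 1 from the others; a value of valuation above p(b + 1)
  -- puts one root closer than that to y', as Krasner's lemma requires.
  obtain ⟨s, hs⟩ := exists_nat_gt (p * (b + 1))
  obtain ⟨y', hy', t', ht', hy1', happ'⟩ := exists_approximation p 𝒪 hL hw hl hlp hn ht hy hy1
    happ (s + 1) (by omega)
  refine ⟨t', ht', ?_⟩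
  have hmon := trinomial_monic p (t := (t' : K)) (w := w) (m := m) hlp
  have hspl : ((trinomial p (t' : K) w m l).map (algebraMap K Ks)).Splits := by
    have : IsSepClosed Ks := IsSepClosure.sep_closed K
    exact IsSepClosed.splits_codomain _ (trinomial_separable p (by simpa using ht'.ne_zero)
      (by simpa using hw.ne_zero) hl hlp)
  have h1 := hspl.eval_eq_prod_roots_of_monic (hmon.map _) y'
  rw [eval_map_algebraMap] at h1
  have hcard : Multiset.card ((trinomial p (t' : K) w m l).map (algebraMap K Ks)).roots = p := by
    rw [← hspl.natDegree_eq_card_roots, natDegree_map, trinomial_natDegree p hlp]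
  obtain ⟨ρ, hρ, hρy⟩ := exists_lt_val_sub (v := ramVal p 𝒪 Ks) (y := y') _ (B := b + 1) (by
    rw [← h1, hcard]
    refine lt_of_lt_of_le (WithTop.coe_lt_coe.mpr ?_) happ'
    push_cast
    have : (0 : ℚ) ≤ n := by positivity
    linarith)
  have hρ0 : aeval ρ (trinomial p (t' : K) w m l) = 0 := by
    rw [← eval_map_algebraMap]
    exact (mem_roots'.mp hρ).2
  refine ⟨ρ, hρ0, ?_⟩
  have hρ1 := (aeval_trinomial_eq_zero_iff p _ _ _ _ _).mp hρ0
  refine adjoin_eq_of_finrank p 𝒪 hL (mem_of_close p 𝒪 hy' (B := ((b + 1 : ℚ) : WithTop ℚ))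
    (fun g hg => ?_) ?_) (ramVal_root p 𝒪 ht' hw hm hl hlp hρ1)
  · refine (ramVal_root_sub p 𝒪 ht' hw hm hl hlp hρ1 hn hb ?_ hg).2.le
    simpa using congrArg g hρ1
  · rw [AddValuation.map_sub_swap]
    exact hρy

end Trinomial

/-! ### From the break to an approximate trinomial -/

section Break

variable {K : Type*} [Field K] (p : ℕ) [hp : Fact p.Prime] [CharP K p]
  (𝒪 : ValuationSubring K)
  {Ks : Type*} [Field Ks] [Algebra K Ks]
variable [IsDiscreteValuationRing 𝒪] [IsAdicComplete (maximalIdeal 𝒪) 𝒪] [IsSepClosure K Ks]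
  {L : IntermediateField K Ks} {m l n : ℕ}

/-- The minimal equation of a prime element of an extension of degree `p` with given break
approximates a trinomial. -/
theorem exists_trinomial_approximation {b : ℚ} (hb : ((p : ℚ) - 1) * b = n)
    (hl : 1 ≤ l) (hlp : l < p) (hn : n + p = m * p + l)
    (hL : L ∈ extensionsWithBreak Ks 𝒪 p b) :
    ∃ y ∈ L, ∃ t w : 𝒪, Irreducible t ∧ IsUnit w ∧ ramVal p 𝒪 Ks y = (1 : ℚ) ∧
      ((n + p + 1 : ℚ) : WithTop ℚ) ≤
        ramVal p 𝒪 Ks (aeval y (trinomial p (t : K) w m l)) := by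
  obtain ⟨hfin, -, σ, -, ⟨x, hxL⟩, hx, hσ⟩ := hL
  rw [ordOf_eq_ramVal p 𝒪 hfin] at hx hσ
  change ramVal p 𝒪 Ks x = (1 : ℚ) at hx
  have hcp : CharP Ks p := charP_of_injective_algebraMap (algebraMap K Ks).injective p
  obtain ⟨a, hxa, ha⟩ := exists_expansion p 𝒪 hfin hxL hx (pow_mem hxL p)
  set ρ := σ ⟨x, hxL⟩ with hρ
  have hρa : ρ ^ p = ∑ i ∈ Finset.range p, algebraMap K Ks (a i) * ρ ^ i := by
    have h1 : (⟨x, hxL⟩ : L) ^ p = ∑ i ∈ Finset.range p, algebraMap K L (a i) * ⟨x, hxL⟩ ^ i := by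
      apply (algebraMap L Ks).injective
      rw [map_pow, map_sum]
      simp only [map_mul, map_pow]
      exact hxa
    have h2 := congrArg σ h1
    rw [map_pow, map_sum] at h2
    simp only [map_mul, map_pow, AlgHom.commutes] at h2
    exact h2
  have hvρ : ramVal p 𝒪 Ks ρ = (1 : ℚ) := by
    rw [← hx]
    apply ramVal_eq_of_minpoly_eq
    rw [hρ, minpoly.algHom_eq σ σ.toRingHom.injective]
    exact (minpoly.algHom_eq L.val L.val.toRingHom.injective ⟨x, hxL⟩).symm
  set v := ramVal p 𝒪 Ks with hv
  have hx0 : x ≠ 0 := by rintro rfl; simp at hx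
  change v (ρ - x) = _ at hσ
  have hne : ρ ≠ x := by
    intro h
    rw [h, sub_self, v.map_zero] at hσ
    exact WithTop.top_ne_coe hσ
  have hvε : v (ρ / x - 1) = b := by
    have h1 : ρ / x - 1 = (ρ - x) / x := by field_simp
    rw [h1, v.map_div, hσ, hx]
    norm_cast
    ring_nf
  have hp2 := hp.out.two_le
  have hp1 : (1 : ℚ) < p := by exact_mod_cast hp.out.one_lt
  have hb0 : 0 ≤ b := by
    have : (0 : ℚ) ≤ n := by positivity
    rw [← hb] at this
    exact (mul_nonneg_iff_of_pos_left (by linarith)).mp this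
  have hvxp : v (x ^ p) = (p : ℚ) := by rw [val_pow_coe hx, mul_one]
  -- The dominant term among the middle ones; the break will identify j with l.
  obtain ⟨j, hj, hjmin⟩ := (Finset.Icc 1 (p - 1)).exists_min_image
    (fun i => v (algebraMap K Ks (a i) * x ^ i)) ⟨1, by simp; omega⟩
  rw [Finset.mem_Icc] at hj
  -- Otherwise all middle coefficients vanish, x^p = a 0 = ρ^p, and injectivity of Frobenius gives ρ
  -- = x.
  have hj0 : a j ≠ 0 := by
    intro h0
    have h1 (i : ℕ) (hi : 1 ≤ i) (hip : i < p) : algebraMap K Ks (a i) = 0 := by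
      have := hjmin i (Finset.mem_Icc.mpr ⟨hi, by omega⟩)
      simp only [h0, map_zero, zero_mul, AddValuation.map_zero, top_le_iff,
        AddValuation.top_iff] at this
      exact (mul_eq_zero.mp this).resolve_right (pow_ne_zero _ hx0)
    have h2 (z : Ks) : ∑ i ∈ Finset.range p, algebraMap K Ks (a i) * z ^ i =
        algebraMap K Ks (a 0) := by
      rw [← Finset.add_sum_erase _ _ (Finset.mem_range.mpr hp.out.pos), pow_zero, mul_one,
        Finset.sum_eq_zero, add_zero]
      intro i hi
      rw [Finset.mem_erase, Finset.mem_range] at hi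
      rw [h1 i (by omega) hi.2, zero_mul]
    have : ExpChar Ks p := ExpChar.prime hp.out
    apply hne
    apply frobenius_inj Ks p
    simp only [frobenius_def]
    rw [hxa, hρa, h2, h2]
  have hjlt (i : ℕ) (hi : 1 ≤ i) (hip : i < p) (hij : i ≠ j) :
      v (algebraMap K Ks (a j) * x ^ j) < v (algebraMap K Ks (a i) * x ^ i) :=
    lt_of_le_of_ne (hjmin i (Finset.mem_Icc.mpr ⟨hi, by omega⟩)) fun h =>
      hij (ramVal_term_injective p 𝒪 hx hj0 (by omega) hip h).symm
  have hvxj : v (x ^ p) < v (algebraMap K Ks (a j) * x ^ j) := by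
    refine lt_of_le_of_ne (ha j (by omega)) fun h => ?_
    obtain ⟨t, ht⟩ := IsDiscreteValuationRing.exists_irreducible 𝒪
    have h1 : v (algebraMap K Ks t * x ^ 0) = v (algebraMap K Ks (a j) * x ^ j) := by
      rw [← h, pow_zero, mul_one, hvxp]
      exact (ramVal_eq_prime_iff p 𝒪 t).mpr ht
    have := ramVal_term_injective p 𝒪 hx (by simpa using ht.ne_zero) hp.out.pos (by omega) h1
    omega
  have hρx : x * (1 + (ρ / x - 1)) = ρ := by field_simp; ring
  have hcl := (close_pow_of_roots (v := v) p (fun i => algebraMap K Ks (a i)) hx0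
    (ε := ρ / x - 1) (l := j) (by rwa [sub_ne_zero, Ne, div_eq_one_iff_eq hx0])
    (by rw [hvε]; exact_mod_cast hb0) hxa (by rw [hρx]; exact hρa) hj.1 (by omega)
    (by simpa using hj0) hvxj hjlt).2.val_eq
  have hvj : v (j : Ks) = 0 := val_natCast p (fun h => by
    have := Nat.le_of_dvd (by omega) h
    omega)
  have hvaj := ramVal_term p 𝒪 hx hj0 j
  rw [val_pow_coe hvε, v.map_div, v.map_mul, hvj, zero_add, hvaj, hvxp, Nat.cast_sub hp.out.one_le,
    Nat.cast_one, hb] at hcl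
  have hq : (n : ℚ) = p * ordBase 𝒪 (a j) + j - p := by exact_mod_cast hcl
  -- Both l and j lie in [1, p-1], so this equation is a division by p with remainder: j = l and ord
  -- (a j) = m.
  have hz : (p : ℤ) * m + l = p * ordBase 𝒪 (a j) + j := by
    have h1 : (n : ℤ) = p * ordBase 𝒪 (a j) + j - p := by exact_mod_cast hq
    have h2 : (n + p : ℤ) = m * p + l := by exact_mod_cast hn
    linarith
  have hjl : l = j := by
    have h2 := congrArg (· % (p : ℤ)) hz
    simp only [Int.mul_add_emod_self_left] at h2
    rw [Int.emod_eq_of_lt (by omega) (by omega), Int.emod_eq_of_lt (by omega) (by omega)] at h2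
    exact_mod_cast h2
  subst hjl
  have hzm : (m : ℤ) = ordBase 𝒪 (a l) := by
    have : (p : ℤ) * m = p * ordBase 𝒪 (a l) := by linarith
    exact mul_left_cancel₀ (by exact_mod_cast hp.out.ne_zero) this
  have hnq : (n + p : ℚ) = m * p + l := by exact_mod_cast hn
  have hval : v (algebraMap K Ks (a l) * x ^ l) = ((n + p : ℚ) : WithTop ℚ) := by
    rw [hvaj, ← hzm, hnq]
    push_cast
    rw [mul_comm]
  have hsum : x ^ p - algebraMap K Ks (a 0) - algebraMap K Ks (a l) * x ^ l =
      ∑ i ∈ ((Finset.range p).erase 0).erase l, algebraMap K Ks (a i) * x ^ i := by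
    rw [hxa, ← Finset.add_sum_erase _ _ (Finset.mem_range.mpr hp.out.pos),
      ← Finset.add_sum_erase _ _ (Finset.mem_erase.mpr ⟨by omega, Finset.mem_range.mpr hlp⟩)]
    ring
  have hrest : ((n + p : ℚ) : WithTop ℚ) <
      v (x ^ p - algebraMap K Ks (a 0) - algebraMap K Ks (a l) * x ^ l) := by
    rw [hsum]
    refine v.map_lt_sum WithTop.coe_ne_top fun i hi => ?_
    simp only [Finset.mem_erase, Finset.mem_range] at hi
    rw [← hval]
    exact hjlt i (by omega) hi.2.2 hi.1
  have hn0 : (0 : ℚ) < n := by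
    rw [hval, hvxp, WithTop.coe_lt_coe] at hvxj
    linarith
  have hva0 : v (algebraMap K Ks (a 0)) = (p : ℚ) := by
    rw [← hvxp]
    refine (v.map_eq_of_lt_sub (x := x ^ p) ?_)
    rw [v.map_sub_swap, hvxp]
    have h1 : x ^ p - algebraMap K Ks (a 0) =
        (x ^ p - algebraMap K Ks (a 0) - algebraMap K Ks (a l) * x ^ l) +
          algebraMap K Ks (a l) * x ^ l := by ring
    have h2 : ((p : ℚ) : WithTop ℚ) < ((n + p : ℚ) : WithTop ℚ) := by
      rw [WithTop.coe_lt_coe]; linarith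
    rw [h1]
    exact v.map_lt_add (h2.trans hrest) (by rw [hval]; exact h2)
  have ha0mem : a 0 ∈ 𝒪 := by
    rw [← ramVal_nonneg_iff p 𝒪 (Ks := Ks), ← hv, hva0]
    exact_mod_cast hp.out.pos.le
  have ha00 : a 0 ≠ 0 := by
    intro h
    rw [h, map_zero, v.map_zero] at hva0
    exact WithTop.top_ne_coe hva0
  have hval' : v (algebraMap K Ks (a l)) = ((m * p : ℚ) : WithTop ℚ) := by
    rw [hv, ramVal_algebraMap p 𝒪 hj0, ← hzm, mul_comm]
    push_cast
    rfl
  have hvw : v (algebraMap K Ks (a l / a 0 ^ m)) = 0 := by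
    rw [map_div₀, map_pow, v.map_div, val_pow_coe hva0, hval']
    exact LinearOrderedAddCommGroupWithTop.sub_self_eq_zero_of_ne_top WithTop.coe_ne_top
  have hwmem : a l / a 0 ^ m ∈ 𝒪 := by
    rw [← ramVal_nonneg_iff p 𝒪 (Ks := Ks), ← hv, hvw]
  have hwunit : IsUnit (⟨a l / a 0 ^ m, hwmem⟩ : 𝒪) := by
    by_contra h
    have := (ramVal_pos_iff p 𝒪 (Ks := Ks) ⟨a l / a 0 ^ m, hwmem⟩).mpr ((mem_maximalIdeal _).mpr h)
    exact this.ne' hvw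
  -- With t = a 0 and w = a l / a 0 ^ m the trinomial keeps the constant and the dominant term. The
  -- omitted terms have valuation above n + p, hence at least n + p + 1 because valuations on L are
  -- integers.
  refine ⟨x, hxL, ⟨a 0, ha0mem⟩, ⟨a l / a 0 ^ m, hwmem⟩,
    (ramVal_eq_prime_iff p 𝒪 (Ks := Ks) ⟨a 0, ha0mem⟩).mp hva0, hwunit, hx, ?_⟩
  rw [aeval_trinomial]
  have h3 : algebraMap K Ks (a l / a 0 ^ m) * algebraMap K Ks (a 0) ^ m = algebraMap K Ks (a l) := by
    rw [← map_pow, ← map_mul, div_mul_cancel₀ _ (pow_ne_zero _ ha00)]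
  simp only [h3]
  have h4 : x ^ p - algebraMap K Ks (a l) * x ^ l - algebraMap K Ks (a 0) =
      x ^ p - algebraMap K Ks (a 0) - algebraMap K Ks (a l) * x ^ l := by ring
  rw [h4]
  have h5 := le_ramVal_of_lt p 𝒪 hfin hxL hx (k := (n + p : ℤ))
    (sub_mem (sub_mem (pow_mem hxL p) (L.algebraMap_mem (a 0)))
      (mul_mem (L.algebraMap_mem (a l)) (pow_mem hxL l))) (by exact_mod_cast hrest)
  exact_mod_cast h5

end Break

/-! ### Normalizing the coefficient; isomorphic fields from the same ω -/

section Classes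

variable {K : Type*} [Field K] (p : ℕ) [hp : Fact p.Prime] [CharP K p]
  (𝒪 : ValuationSubring K)
  {Ks : Type*} [Field Ks] [Algebra K Ks]
variable [IsDiscreteValuationRing 𝒪] [IsAdicComplete (maximalIdeal 𝒪) 𝒪]
  [PerfectField (ResidueField 𝒪)] [IsSepClosure K Ks]
  {L : IntermediateField K Ks} {m l n : ℕ}

omit [IsAdicComplete (maximalIdeal 𝒪) 𝒪] [PerfectField (ResidueField 𝒪)] [IsSepClosure K Ks] hp
  [CharP K p] [IsDiscreteValuationRing 𝒪] in
theorem sub_mem_of_residue_eq {a c : 𝒪} (h : residue 𝒪 a = residue 𝒪 c) :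
    a - c ∈ maximalIdeal 𝒪 := by
  rw [← residue_eq_zero_iff, map_sub, h, sub_self]

omit [CharP K p] [PerfectField (ResidueField 𝒪)] in
theorem le_ramVal_of_mem_maximalIdeal {a : 𝒪} (h : a ∈ maximalIdeal 𝒪) :
    ((p : ℚ) : WithTop ℚ) ≤ ramVal p 𝒪 Ks (algebraMap K Ks a) := by
  obtain ⟨t, ht⟩ := IsDiscreteValuationRing.exists_irreducible 𝒪
  rw [ht.maximalIdeal_eq, Ideal.mem_span_singleton] at h
  obtain ⟨c, rfl⟩ := h
  have h1 := (ramVal_eq_prime_iff p 𝒪 (Ks := Ks) t).mpr ht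
  have h2 := (ramVal_nonneg_iff p 𝒪 (Ks := Ks) c).mpr c.2
  rw [show ((t * c : 𝒪) : K) = t * c from rfl, map_mul (algebraMap K Ks), AddValuation.map_mul, h1]
  exact le_add_of_nonneg_right h2

omit [CharP K p] [PerfectField (ResidueField 𝒪)] in
theorem residue_eq_of_close {a c : 𝒪} (hc : IsUnit c)
    (h : Close (ramVal p 𝒪 Ks) (algebraMap K Ks a) (algebraMap K Ks c)) :
    residue 𝒪 a = residue 𝒪 c := by
  have h1 := h.lt
  rw [ramVal_eq_zero_of_isUnit p 𝒪 hc, ← map_sub] at h1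
  have h2 := (ramVal_pos_iff p 𝒪 (Ks := Ks) (a - c)).mp (by exact_mod_cast h1)
  rwa [← residue_eq_zero_iff, map_sub, sub_eq_zero] at h2

omit [CharP K p] [PerfectField (ResidueField 𝒪)] in
theorem exists_unit_close (hL : Module.finrank K L = p) {π y : Ks} (hπL : π ∈ L)
    (hπ : ramVal p 𝒪 Ks π = (1 : ℚ)) (hy : y ∈ L) (hy0 : ramVal p 𝒪 Ks y = 0) :
    ∃ e : 𝒪, IsUnit e ∧ Close (ramVal p 𝒪 Ks) (algebraMap K Ks e) y := by
  obtain ⟨e, he⟩ := exists_sub_algebraMap_pos p 𝒪 hL hπL hπ hy hy0.ge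
  have hc : Close (ramVal p 𝒪 Ks) (algebraMap K Ks e) y :=
    Close.of_lt (by rwa [AddValuation.map_sub_swap, hy0])
  refine ⟨e, ?_, hc⟩
  by_contra h
  have := (ramVal_pos_iff p 𝒪 (Ks := Ks) e).mpr ((mem_maximalIdeal _).mpr h)
  rw [hc.val_eq, hy0] at this
  exact lt_irrefl _ this

/-- Every extension of degree `p` with the given break is generated by a root of a trinomial with
coefficient in any prescribed set of representatives modulo `n`-th powers. -/
theorem exists_root_generator {b : ℚ} (hb : ((p : ℚ) - 1) * b = n)
    (hm : 1 ≤ m) (hl : 1 ≤ l) (hlp : l < p) (hn : n + p = m * p + l)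
    (hL : L ∈ extensionsWithBreak Ks 𝒪 p b) {R : Set (ResidueField 𝒪)ˣ}
    (hR : ∀ g : (ResidueField 𝒪)ˣ, ∃ ω ∈ R, ∃ u : (ResidueField 𝒪)ˣ, g = ω * u ^ n) :
    ∃ ω ∈ R, ∃ t : 𝒪, Irreducible t ∧ ∃ ρ : Ks,
      aeval ρ (trinomial p (t : K) (teichmuller p 𝒪 (ω : ResidueField 𝒪)) m l) = 0 ∧ K⟮ρ⟯ = L := by
  obtain ⟨x, hxL, t, w, ht, hw, hx, happ⟩ := exists_trinomial_approximation p 𝒪 hb hl hlp hn hL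
  obtain ⟨ω, hω, u, hu⟩ := hR (hw.map (residue 𝒪)).unit
  refine ⟨ω, hω, ?_⟩
  have hwres : residue 𝒪 w = residue 𝒪 (teichmuller p 𝒪 (ω : ResidueField 𝒪) *
      teichmuller p 𝒪 (u : ResidueField 𝒪) ^ n) := by
    rw [map_mul, map_pow, residue_teichmuller, residue_teichmuller]
    exact congrArg Units.val hu
  set W := teichmuller p 𝒪 (ω : ResidueField 𝒪) with hW
  have hWu : IsUnit W := isUnit_teichmuller p 𝒪 ω
  set U := teichmuller p 𝒪 (u : ResidueField 𝒪) with hU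
  have hUu : IsUnit U := isUnit_teichmuller p 𝒪 u
  -- Passing from (x, t) to (U x, U^p t) divides the coefficient by U^n, as n + p = mp + l.
  -- Replacing w by the Teichmüller element W U^n changes it by an element of valuation at least p,
  -- which the error bound tolerates.
  have ht' : Irreducible (U ^ p * t) :=
    ((associated_unit_mul_right t (U ^ p) (hUu.pow p))).irreducible ht
  have hvU : ramVal p 𝒪 Ks (algebraMap K Ks U) = 0 := ramVal_eq_zero_of_isUnit p 𝒪 hUu
  have hvt := (ramVal_eq_prime_iff p 𝒪 (Ks := Ks) t).mpr ht
  have hnq : (n + p : ℚ) = m * p + l := by exact_mod_cast hn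
  have hp1 : (1 : ℚ) < p := by exact_mod_cast hp.out.one_lt
  refine (exists_root_of_approximation p 𝒪 hL.1 hWu hl hlp hm hn ht' (y := algebraMap K Ks U * x)
    (mul_mem (L.algebraMap_mem _) hxL) ?_ ?_).imp fun _ h => h
  · rw [AddValuation.map_mul, hvU, hx, zero_add]
  · have h1 := le_ramVal_of_mem_maximalIdeal p 𝒪 (Ks := Ks) (sub_mem_of_residue_eq 𝒪 hwres)
    set v := ramVal p 𝒪 Ks
    have key : aeval (algebraMap K Ks U * x) (trinomial p ((U ^ p * t : 𝒪) : K) W m l) =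
        algebraMap K Ks U ^ p * (aeval x (trinomial p (t : K) w m l) +
          algebraMap K Ks ((w - W * U ^ n : 𝒪) : K) *
            (algebraMap K Ks t ^ m * x ^ l)) := by
      have h2 : algebraMap K Ks U ^ n * algebraMap K Ks U ^ p =
          (algebraMap K Ks U ^ p) ^ m * algebraMap K Ks U ^ l := by
        rw [← pow_add, ← pow_mul, ← pow_add, hn, mul_comm p m]
      rw [aeval_trinomial, aeval_trinomial, show ((U ^ p * t : 𝒪) : K) = (U : K) ^ p * t from rfl,
        show ((w - W * U ^ n : 𝒪) : K) = w - W * (U : K) ^ n from rfl]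
      simp only [map_mul, map_pow, map_sub]
      linear_combination (algebraMap K Ks W * algebraMap K Ks t ^ m * x ^ l) * h2
    rw [key]
    have h3 := le_val_mul (v := v) (le_val_pow (r := 0) hvU.ge p) (v.map_le_add happ (le_val_mono
      (s := n + p + 1) ?_ (le_val_mul h1 (le_val_mul (le_val_pow hvt.ge m) (le_val_pow hx.ge l)))))
    · exact le_val_mono (by linarith) h3
    · linarith

omit [CharP K p] [PerfectField (ResidueField 𝒪)] in
theorem minpoly_root {t w : 𝒪} (ht : Irreducible t) (hw : IsUnit w) (hm : 1 ≤ m)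
    (hl : 1 ≤ l) (hlp : l < p) {ρ : Ks} (hρ : aeval ρ (trinomial p (t : K) w m l) = 0) :
    minpoly K ρ = trinomial p (t : K) w m l := by
  have hi : IsIntegral K ρ := Algebra.IsIntegral.isIntegral ρ
  refine Polynomial.eq_of_monic_of_dvd_of_natDegree_le (minpoly.monic hi)
    (trinomial_monic p hlp) (minpoly.dvd K ρ hρ) ?_ |>.symm ▸ rfl
  rw [trinomial_natDegree p hlp, ← IntermediateField.adjoin.finrank hi]
  exact (finrank_adjoin_root p 𝒪 ht hw hm hl hlp
    ((aeval_trinomial_eq_zero_iff p _ _ _ _ _).mp hρ)).ge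

/-- Roots of trinomials with the same `ω` generate `k`-isomorphic extensions. -/
theorem isKIsomorphic_of_roots {t t' : 𝒪} (ht : Irreducible t) (ht' : Irreducible t')
    (ω : (ResidueField 𝒪)ˣ) (hm : 1 ≤ m) (hl : 1 ≤ l) (hlp : l < p) {ρ ρ' : Ks}
    (hρ : aeval ρ (trinomial p (t : K) (teichmuller p 𝒪 (ω : ResidueField 𝒪)) m l) = 0)
    (hρ' : aeval ρ' (trinomial p (t' : K) (teichmuller p 𝒪 (ω : ResidueField 𝒪)) m l) = 0) :
    IsKIsomorphic p 𝒪 K⟮ρ⟯ K⟮ρ'⟯ := by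
  -- φ fixes ω, so it carries one minimal polynomial to the other and extends to the fields they
  -- define.
  obtain ⟨φ, hφt, hφ⟩ := exists_ringEquiv_map_prime p 𝒪 ht ht'
  have hw := isUnit_teichmuller p 𝒪 ω
  have h1 : (minpoly K ρ).map (φ : K →+* K) = minpoly K ρ' := by
    rw [minpoly_root p 𝒪 ht hw hm hl hlp hρ, minpoly_root p 𝒪 ht' hw hm hl hlp hρ']
    simp only [trinomial, Polynomial.map_sub, Polynomial.map_mul, Polynomial.map_pow, map_X, map_C,
      map_mul, map_pow, RingEquiv.coe_toRingHom, hφt, hφ (ω : ResidueField 𝒪)]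
  have h2 : Associated ((minpoly K ρ).map (φ : K →+* K)) (minpoly K ρ') := h1 ▸ Associated.refl _
  have hi : IsIntegral K ρ := Algebra.IsIntegral.isIntegral ρ
  have hi' : IsIntegral K ρ' := Algebra.IsIntegral.isIntegral ρ'
  refine ⟨(IntermediateField.adjoinRootEquivAdjoin K hi).symm.toRingEquiv.trans
    ((AdjoinRoot.mapRingEquiv φ _ _ h2).trans
      (IntermediateField.adjoinRootEquivAdjoin K hi').toRingEquiv), φ, fun x => ?_, hφ⟩
  change IntermediateField.adjoinRootEquivAdjoin K hi' (AdjoinRoot.mapRingEquiv φ _ _ h2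
    ((IntermediateField.adjoinRootEquivAdjoin K hi).symm (algebraMap K K⟮ρ⟯ x))) = _
  rw [AlgEquiv.commutes, AdjoinRoot.coe_mapRingEquiv, AdjoinRoot.algebraMap_eq, AdjoinRoot.map_of,
    ← AdjoinRoot.algebraMap_eq]
  exact AlgEquiv.commutes _ _

end Classes

/-! ### Invariance of the class of ω and the Galois criterion -/

section Main

variable {K : Type*} [Field K] (p : ℕ) [hp : Fact p.Prime] [CharP K p]
  (𝒪 : ValuationSubring K)
  {Ks : Type*} [Field Ks] [Algebra K Ks]
variable [IsDiscreteValuationRing 𝒪] [IsAdicComplete (maximalIdeal 𝒪) 𝒪]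
  [PerfectField (ResidueField 𝒪)] [IsSepClosure K Ks]
  {m l n : ℕ}

/-- The class of `ω` modulo `n`-th powers is determined by the `k`-isomorphism class. -/
theorem exists_eq_mul_pow_of_isKIsomorphic {t : 𝒪} (ht : Irreducible t)
    (ω₁ ω₂ : (ResidueField 𝒪)ˣ) (hm : 1 ≤ m) (hl : 1 ≤ l) (hlp : l < p)
    (hn : n + p = m * p + l) {ρ₁ ρ₂ : Ks}
    (hρ₁ : aeval ρ₁ (trinomial p (t : K) (teichmuller p 𝒪 (ω₁ : ResidueField 𝒪)) m l) = 0)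
    (hρ₂ : aeval ρ₂ (trinomial p (t : K) (teichmuller p 𝒪 (ω₂ : ResidueField 𝒪)) m l) = 0)
    (h : IsKIsomorphic p 𝒪 K⟮ρ₁⟯ K⟮ρ₂⟯) : ∃ u : (ResidueField 𝒪)ˣ, ω₂ = ω₁ * u ^ n := by
  obtain ⟨σ, φ, hσ, hφ⟩ := h
  obtain ⟨t', ht', htφ⟩ := ringEquiv_map_irreducible p 𝒪 φ ht
  set W₁ := teichmuller p 𝒪 (ω₁ : ResidueField 𝒪) with hW₁
  set W₂ := teichmuller p 𝒪 (ω₂ : ResidueField 𝒪) with hW₂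
  have hu₁ : IsUnit W₁ := isUnit_teichmuller p 𝒪 ω₁
  have hu₂ : IsUnit W₂ := isUnit_teichmuller p 𝒪 ω₂
  rw [aeval_trinomial_eq_zero_iff] at hρ₁ hρ₂
  set y : K⟮ρ₂⟯ := σ (IntermediateField.AdjoinSimple.gen K ρ₁) with hy
  -- σ is only φ-semilinear, but φ fixes k: the coefficient ω₁ survives and t becomes the prime t' =
  -- φ t.
  have hyroot : (y : Ks) ^ p =
      algebraMap K Ks W₁ * algebraMap K Ks t' ^ m * (y : Ks) ^ l + algebraMap K Ks t' := by
    have h1 : IntermediateField.AdjoinSimple.gen K ρ₁ ^ p =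
        algebraMap K K⟮ρ₁⟯ W₁ * algebraMap K K⟮ρ₁⟯ t ^ m *
          IntermediateField.AdjoinSimple.gen K ρ₁ ^ l + algebraMap K K⟮ρ₁⟯ t := by
      apply (algebraMap K⟮ρ₁⟯ Ks).injective
      simp only [map_pow, map_add, map_mul, IntermediateField.AdjoinSimple.algebraMap_gen]
      exact hρ₁
    have h2 := congrArg σ h1
    simp only [map_pow, map_add, map_mul, hσ] at h2
    rw [hφ (ω₁ : ResidueField 𝒪), ← htφ] at h2
    have h3 := congrArg (algebraMap K⟮ρ₂⟯ Ks) h2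
    simp only [map_pow, map_add, map_mul] at h3
    exact h3
  have hvρ := ramVal_root p 𝒪 ht hu₂ hm hl hlp hρ₂
  have hvy := ramVal_root p 𝒪 ht' hu₁ hm hl hlp hyroot
  have hfin := finrank_adjoin_root p 𝒪 ht hu₂ hm hl hlp hρ₂
  have hmem := IntermediateField.mem_adjoin_simple_self K ρ₂
  obtain ⟨g, hg⟩ := exists_conj_ne p 𝒪 hfin hmem hvρ
  have hgρ : (g ρ₂) ^ p =
      algebraMap K Ks W₂ * algebraMap K Ks t ^ m * (g ρ₂) ^ l + algebraMap K Ks t := by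
    simpa using congrArg g hρ₂
  have hgy : (g y) ^ p =
      algebraMap K Ks W₁ * algebraMap K Ks t' ^ m * (g y) ^ l + algebraMap K Ks t' := by
    simpa using congrArg g hyroot
  obtain ⟨h1, h2⟩ := close_root_div_pow p 𝒪 ht hu₂ hm hl hlp hρ₂ hn hgρ hg
  have h3 := close_conj_div_sub_one p 𝒪 hfin hmem hvρ y.2 hvy g hg h1
  have hρ0 : ρ₂ ≠ 0 := by rintro rfl; simp at hvρ
  have hy0 : (y : Ks) ≠ 0 := by intro h0; rw [h0] at hvy; simp at hvy
  have hgyne : g y ≠ y := by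
    intro h0
    apply h3.ne_left
    rw [h0, div_self hy0, sub_self]
  have h4 := (close_root_div_pow p 𝒪 ht' hu₁ hm hl hlp hyroot hn hgy hgyne).2
  -- Two values for the leading term of (gρ₂/ρ₂ - 1)^(p-1), one from ρ₂ and one from y: l ω₂ ρ₂^n ~
  -- l ω₁ y^n.
  have h5 := (h2.symm.trans (h3.symm.pow (p - 1))).trans h4
  obtain ⟨e, he, hec⟩ := exists_unit_close p 𝒪 hfin hmem hvρ (div_mem y.2 hmem) (by
    rw [AddValuation.map_div, hvy, hvρ]
    exact LinearOrderedAddCommGroupWithTop.sub_self_eq_zero_of_ne_top WithTop.coe_ne_top)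
  have hl0 : (l : Ks) ≠ 0 := fun h0 => h5.ne_left (by rw [h0]; ring)
  have h6 : Close (ramVal p 𝒪 Ks) (algebraMap K Ks W₂) (algebraMap K Ks ((W₁ * e ^ n : 𝒪) : K)) := by
    have h7 := h5.mul (Close.refl (v := ramVal p 𝒪 Ks) (x := ((l : Ks) * ρ₂ ^ n)⁻¹)
      (inv_ne_zero (mul_ne_zero hl0 (pow_ne_zero _ hρ0))))
    have h8 := (Close.refl (v := ramVal p 𝒪 Ks) (x := algebraMap K Ks W₁)
      (by simpa using hu₁.ne_zero)).mul (hec.symm.pow n)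
    have h9 : (l : Ks) * algebraMap K Ks W₂ * ρ₂ ^ n * ((l : Ks) * ρ₂ ^ n)⁻¹ =
        algebraMap K Ks W₂ := by field_simp
    have h10 : (l : Ks) * algebraMap K Ks W₁ * (y : Ks) ^ n * ((l : Ks) * ρ₂ ^ n)⁻¹ =
        algebraMap K Ks W₁ * ((y : Ks) / ρ₂) ^ n := by
      rw [div_pow]; field_simp
    rw [h9, h10] at h7
    rw [show ((W₁ * e ^ n : 𝒪) : K) = (W₁ : K) * (e : K) ^ n from rfl, map_mul, map_pow]
    exact h7.trans h8
  have h11 := residue_eq_of_close p 𝒪 (hu₁.mul (he.pow n)) h6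
  rw [map_mul, map_pow, residue_teichmuller, residue_teichmuller] at h11
  exact ⟨(he.map (residue 𝒪)).unit, Units.ext h11⟩

omit [IsDiscreteValuationRing 𝒪] in
theorem teichmuller_natCast_mul (i : ℕ) (a : ResidueField 𝒪) :
    teichmuller p 𝒪 (i * a) = i * teichmuller p 𝒪 a := by
  rw [← teichmullerHom_apply, map_mul, map_natCast, teichmullerHom_apply]

omit [CharP K p] [PerfectField (ResidueField 𝒪)] [IsDiscreteValuationRing 𝒪]
  [IsAdicComplete (maximalIdeal 𝒪) 𝒪] [IsSepClosure K Ks] in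
/-- An element whose `(p - 1)`-st power is close to `1` is close to an integer. -/
theorem exists_natCast_close [CharP Ks p] {v : AddValuation Ks (WithTop ℚ)} {z : Ks}
    (hz : Close v (z ^ (p - 1)) 1) : ∃ j : ℕ, 0 < v (z - j) := by
  let := ZMod.algebra Ks p
  have hz0 : z ≠ 0 := by
    intro h
    apply hz.ne_left
    rw [h, zero_pow]
    have := hp.out.two_le
    omega
  have hvz : 0 ≤ v z := by
    obtain ⟨r, hr⟩ := exists_val_eq (v := v) hz0
    have h1 := hz.val_eq
    rw [val_pow_coe hr, v.map_one, ← WithTop.coe_zero, WithTop.coe_inj, mul_eq_zero] at h1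
    rcases h1 with h1 | h1
    · have := hp.out.two_le
      rw [Nat.cast_eq_zero] at h1
      omega
    · rw [hr, h1]; rfl
  have hmon : (X ^ p - X : (ZMod p)[X]).Monic :=
    monic_X_pow_sub (by rw [degree_X]; exact_mod_cast hp.out.one_lt)
  have hroots : (X ^ p - X : (ZMod p)[X]).roots = Finset.univ.val := by
    have := FiniteField.roots_X_pow_card_sub_X (ZMod p)
    rwa [ZMod.card] at this
  have hspl : (X ^ p - X : (ZMod p)[X]).Splits := by
    rw [splits_iff_card_roots, hroots, FiniteField.X_pow_card_sub_X_natDegree_eq _ hp.out.one_lt]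
    simp [ZMod.card]
  -- z^p - z is the product of z - j over j in 𝔽_p and has positive valuation, so one factor does.
  have h1 := (hspl.map (algebraMap (ZMod p) Ks)).eval_eq_prod_roots_of_monic (hmon.map _) z
  rw [hspl.roots_map, hroots, eval_map_algebraMap] at h1
  have h2 : 0 < v (aeval z (X ^ p - X : (ZMod p)[X])) := by
    have h3 : aeval z (X ^ p - X : (ZMod p)[X]) = (z ^ (p - 1) - 1) * z := by
      have : z ^ p = z ^ (p - 1) * z := by rw [← pow_succ, Nat.sub_add_cancel hp.out.one_le]
      simp only [map_sub, map_pow, aeval_X]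
      rw [this]; ring
    rw [h3]
    exact val_mul_pos (Close.one_iff.mp hz) hvz
  obtain ⟨a, ha, haz⟩ := exists_lt_val_sub (v := v) (y := z) _ (B := 0) (by
    rw [← h1, mul_zero]; exact_mod_cast h2)
  obtain ⟨j, -, rfl⟩ := Multiset.mem_map.mp ha
  refine ⟨j.val, ?_⟩
  have : ((j.val : ℕ) : Ks) = algebraMap (ZMod p) Ks j := by
    rw [← map_natCast (algebraMap (ZMod p) Ks), ZMod.natCast_zmod_val]
  rw [this]
  exact_mod_cast haz

/-- Put ε = gρ/ρ - 1, so ε^(p-1) ~ l ω ρ^n. If gρ ∈ K(ρ), then v(ε) = b is an integer N, and the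
residue of ε/ρ^N is a (p-1)-st root of l ω. Conversely, such a root c gives ε ~ j c ρ^N with j in
𝔽_p, and Krasner's lemma yields gρ ∈ K(ρ). -/
theorem isGalois_adjoin_root_iff {t : 𝒪} (ht : Irreducible t)
    (ω : (ResidueField 𝒪)ˣ) (hm : 1 ≤ m) (hl : 1 ≤ l) (hlp : l < p)
    (hn : n + p = m * p + l) (hpn : ¬ p ∣ n) {b : ℚ} (hb : ((p : ℚ) - 1) * b = n) {ρ : Ks}
    (hρ : aeval ρ (trinomial p (t : K) (teichmuller p 𝒪 (ω : ResidueField 𝒪)) m l) = 0) :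
    IsGalois K K⟮ρ⟯ ↔ (∃ N : ℕ, ¬ p ∣ N ∧ b = N) ∧
        ∃ c : (ResidueField 𝒪)ˣ, (c : ResidueField 𝒪) ^ (p - 1) = (l : ResidueField 𝒪) * ω := by
  set W := teichmuller p 𝒪 (ω : ResidueField 𝒪) with hW
  have hu : IsUnit W := isUnit_teichmuller p 𝒪 ω
  rw [aeval_trinomial_eq_zero_iff] at hρ
  have hcp : CharP Ks p := charP_of_injective_algebraMap (algebraMap K Ks).injective p
  have hvρ := ramVal_root p 𝒪 ht hu hm hl hlp hρ
  have hfin := finrank_adjoin_root p 𝒪 ht hu hm hl hlp hρ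
  have hmem := IntermediateField.mem_adjoin_simple_self K ρ
  have hρ0 : ρ ≠ 0 := by rintro rfl; simp at hvρ
  have hgρ (g : Ks ≃ₐ[K] Ks) : (g ρ) ^ p =
      algebraMap K Ks W * algebraMap K Ks t ^ m * (g ρ) ^ l + algebraMap K Ks t := by
    simpa using congrArg g hρ
  have hp1 : (1 : ℚ) < p := by exact_mod_cast hp.out.one_lt
  have hnN {N : ℕ} (hN : b = N) : n = N * (p - 1) := by
    rw [hN] at hb
    have h1 : ((N * (p - 1) : ℕ) : ℚ) = n := by
      rw [← hb, Nat.cast_mul, Nat.cast_sub hp.out.one_le, Nat.cast_one, mul_comm]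
    exact_mod_cast h1.symm
  constructor
  · intro hG
    have hN := IntermediateField.normal_iff_forall_map_le'.mp hG.to_normal
    obtain ⟨g, hg⟩ := exists_conj_ne p 𝒪 hfin hmem hvρ
    have hgmem : g ρ ∈ K⟮ρ⟯ := hN g ⟨ρ, hmem, rfl⟩
    have hclose := (close_root_div_pow p 𝒪 ht hu hm hl hlp hρ hn (hgρ g) hg).2
    have hvε := (ramVal_root_sub p 𝒪 ht hu hm hl hlp hρ hn hb (hgρ g) hg).1
    have hεmem : g ρ / ρ - 1 ∈ K⟮ρ⟯ := sub_mem (div_mem hgmem hmem) (one_mem _)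
    have hε0 : g ρ / ρ - 1 ≠ 0 := by
      rw [← AddValuation.ne_top_iff (ramVal p 𝒪 Ks), hvε]
      exact WithTop.coe_ne_top
    obtain ⟨z, hz⟩ := exists_ramVal_eq_int p 𝒪 hfin hmem hvρ hεmem hε0
    rw [hvε, WithTop.coe_inj] at hz
    have hz0 : 0 ≤ z := by
      have h1 : (0 : ℚ) ≤ n := by positivity
      rw [← hb, hz] at h1
      have := (mul_nonneg_iff_of_pos_left (by linarith)).mp h1
      exact_mod_cast this
    obtain ⟨N, rfl⟩ := Int.eq_ofNat_of_zero_le hz0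
    rw [Int.cast_natCast] at hz
    have hnN' := hnN hz
    refine ⟨⟨N, fun h => hpn (hnN' ▸ h.mul_right _), hz⟩, ?_⟩
    obtain ⟨e, he, hec⟩ := exists_unit_close p 𝒪 hfin hmem hvρ
      (div_mem hεmem (pow_mem hmem N)) (by
        rw [AddValuation.map_div, hvε, val_pow_coe hvρ, hz, mul_one]
        exact LinearOrderedAddCommGroupWithTop.sub_self_eq_zero_of_ne_top WithTop.coe_ne_top)
    refine ⟨(he.map (residue 𝒪)).unit, ?_⟩
    have h1 : Close (ramVal p 𝒪 Ks) (algebraMap K Ks ((e ^ (p - 1) : 𝒪) : K))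
        (algebraMap K Ks ((l * W : 𝒪) : K)) := by
      have h2 := (hec.pow (p - 1)).trans (by
        rw [div_pow, ← pow_mul, ← hnN']
        exact hclose.div (Close.refl (pow_ne_zero _ hρ0)))
      rw [mul_div_cancel_right₀ _ (pow_ne_zero _ hρ0)] at h2
      simpa using h2
    have hlu : IsUnit ((l : 𝒪) * W) := by
      by_contra h
      have h2 := (ramVal_pos_iff p 𝒪 (Ks := Ks) (l * W)).mpr ((mem_maximalIdeal _).mpr h)
      rw [← h1.val_eq, ramVal_eq_zero_of_isUnit p 𝒪 (he.pow _)] at h2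
      exact lt_irrefl _ h2
    have h2 := residue_eq_of_close p 𝒪 hlu h1
    rw [map_mul, map_pow, map_natCast, hW, residue_teichmuller] at h2
    exact h2
  · rintro ⟨⟨N, -, hN⟩, c, hc⟩
    have hnN' := hnN hN
    set U := teichmuller p 𝒪 (c : ResidueField 𝒪) with hU
    have hUu : IsUnit U := isUnit_teichmuller p 𝒪 c
    have hvU : ramVal p 𝒪 Ks (algebraMap K Ks U) = 0 := ramVal_eq_zero_of_isUnit p 𝒪 hUu
    have hU0 : algebraMap K Ks U ≠ 0 := by simpa using hUu.ne_zero
    have hUW : algebraMap K Ks U ^ (p - 1) = l * algebraMap K Ks W := by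
      have h1 : U ^ (p - 1) = l * W := by
        rw [hU, ← map_pow, hc, teichmuller_natCast_mul]
      have h2 := congrArg (fun x : 𝒪 => algebraMap K Ks (x : K)) h1
      simpa using h2
    have hnormal : Normal K K⟮ρ⟯ := by
      rw [IntermediateField.normal_iff_forall_map_le']
      intro g
      rw [IntermediateField.adjoin_map, Set.image_singleton,
        IntermediateField.adjoin_simple_le_iff]
      change g ρ ∈ K⟮ρ⟯
      by_cases hg : g ρ = ρ
      · rwa [hg]
      have hclose := (close_root_div_pow p 𝒪 ht hu hm hl hlp hρ hn (hgρ g) hg).2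
      have hUρ0 : algebraMap K Ks U * ρ ^ N ≠ 0 := mul_ne_zero hU0 (pow_ne_zero _ hρ0)
      have hz : Close (ramVal p 𝒪 Ks)
          (((g ρ / ρ - 1) / (algebraMap K Ks U * ρ ^ N)) ^ (p - 1)) 1 := by
        rw [div_pow, mul_pow, hUW, ← pow_mul, ← hnN']
        have h1 := hclose.div (Close.refl (v := ramVal p 𝒪 Ks) hclose.ne_right)
        rwa [div_self hclose.ne_right] at h1
      obtain ⟨j, hj⟩ := exists_natCast_close p hz
      -- This element of K(ρ) agrees with gρ beyond valuation v(ρ · c ρ^N) = b + 1, the valuation of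
      -- the difference of any two distinct roots.
      refine mem_of_close p 𝒪 (y := ρ * (1 + j * (algebraMap K Ks U * ρ ^ N)))
        (mul_mem hmem (add_mem (one_mem _) (mul_mem (natCast_mem _ j)
          (mul_mem (IntermediateField.algebraMap_mem _ _) (pow_mem hmem N)))))
        (B := ((b + 1 : ℚ) : WithTop ℚ)) (fun g' hg' => ?_) ?_
      · refine (ramVal_root_sub p 𝒪 ht hu hm hl hlp (hgρ g) hn hb ?_ hg').2.le
        exact hgρ (g' * g)
      · have h1 : g ρ - ρ * (1 + j * (algebraMap K Ks U * ρ ^ N)) =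
            ρ * (algebraMap K Ks U * ρ ^ N) *
              ((g ρ / ρ - 1) / (algebraMap K Ks U * ρ ^ N) - j) := by
          field_simp
          ring
        have h2 : ramVal p 𝒪 Ks (ρ * (algebraMap K Ks U * ρ ^ N)) =
            ((b + 1 : ℚ) : WithTop ℚ) := by
          rw [AddValuation.map_mul, AddValuation.map_mul, hvU, hvρ, val_pow_coe hvρ, zero_add,
            ← WithTop.coe_add, hN]
          congr 1
          ring
        rw [h1]
        refine (h2.symm.trans_lt (Close.lt (v := ramVal p 𝒪 Ks) (x := ρ * (algebraMap K Ks U * ρ ^ N) *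
          (1 + ((g ρ / ρ - 1) / (algebraMap K Ks U * ρ ^ N) - j)))
          (y := ρ * (algebraMap K Ks U * ρ ^ N)) ?_)).trans_eq ?_
        · rw [Close, mul_div_cancel_left₀ _ (mul_ne_zero hρ0 hUρ0), add_sub_cancel_left]
          exact hj
        · congr 1
          ring
    exact { to_isSeparable := inferInstance, to_normal := hnormal }

end Main

end LocalFieldExt

/-! ### The classification theorem -/

theorem theorem1 {K Ks : Type*} [Field K] [Field Ks] [Algebra K Ks] [IsSepClosure K Ks]
    (p : ℕ) [Fact p.Prime] [CharP K p]
    -- `K` is a local field of characteristic `p` with perfect residue field, `πK` a prime element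
    (𝒪 : ValuationSubring K) [IsDiscreteValuationRing 𝒪] [IsAdicComplete (maximalIdeal 𝒪) 𝒪]
    [PerfectField (ResidueField 𝒪)] (πK : 𝒪) (hπK : Irreducible πK)
    -- `n = (p - 1) b` is a natural number that is not a multiple of `p`
    (b : ℚ) (n : ℕ) (hpn : ¬ p ∣ n) (hb : ((p : ℚ) - 1) * b = n)
    (m l : ℕ) (hl : 1 ≤ l) (hlp : l ≤ p - 1)
    (hbml : b = (((m : ℚ) - 1) * p + l) / ((p : ℚ) - 1))
    -- `R` is a set of coset representatives for `k^× / (k^×)^((p - 1) b)`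
    (R : Set (ResidueField 𝒪)ˣ)
    (hR : Subgroup.IsComplement R
      ((powMonoidHom n : (ResidueField 𝒪)ˣ →* (ResidueField 𝒪)ˣ).range : Set (ResidueField 𝒪)ˣ))
    (π : R → Ks)
    (hπ : ∀ ω : R, aeval (π ω) (LocalFieldExt.amanoPolynomial p πK m l ω.1) = 0) :
    (∃ hE : ∀ ω : R, K⟮π ω⟯ ∈ LocalFieldExt.extensionsWithBreak Ks 𝒪 p b,
      Function.Bijective (fun ω : R =>
        (Quotient.mk _ ⟨K⟮π ω⟯, hE ω⟩ : LocalFieldExt.KIsoClasses Ks p 𝒪 b))) ∧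
    ∀ ω : R, IsGalois K K⟮π ω⟯ ↔
      (∃ N : ℕ, ¬ p ∣ N ∧ b = N) ∧
        ∃ c : (ResidueField 𝒪)ˣ, (c : ResidueField 𝒪) ^ (p - 1) = (l : ResidueField 𝒪) * ω.1 := by
  have hp2 := (Fact.out : p.Prime).two_le
  have hlt : l < p := by omega
  have hn : n + p = m * p + l := by
    have hp1 : (p : ℚ) - 1 ≠ 0 := by
      have : (2 : ℚ) ≤ p := by exact_mod_cast hp2
      linarith
    rw [hbml, mul_div_cancel₀ _ hp1] at hb
    have : (n + p : ℚ) = m * p + l := by linarith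
    exact_mod_cast this
  have hm : 1 ≤ m := by
    by_contra h
    have : m = 0 := by omega
    subst this
    omega
  have hE (ω : R) : K⟮π ω⟯ ∈ LocalFieldExt.extensionsWithBreak Ks 𝒪 p b :=
    LocalFieldExt.root_mem_extensionsWithBreak p 𝒪 hπK
      (LocalFieldExt.isUnit_teichmuller p 𝒪 ω.1) hm hl hlt
      ((LocalFieldExt.aeval_trinomial_eq_zero_iff p _ _ _ _ _).mp (hπ ω)) hn hb
  refine ⟨⟨hE, fun ω₁ ω₂ h => ?_, fun x => ?_⟩, fun ω =>
    LocalFieldExt.isGalois_adjoin_root_iff p 𝒪 hπK ω.1 hm hl hlt hn hpn hb (hπ ω)⟩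
  · obtain ⟨u, hu⟩ := LocalFieldExt.exists_eq_mul_pow_of_isKIsomorphic p 𝒪 hπK ω₁.1 ω₂.1 hm hl hlt
      hn (hπ ω₁) (hπ ω₂) (Quotient.exact h)
    -- Uniqueness of the factorization in the complement, applied to ω₁ · u^n = ω₂ · 1.
    have h1 := @hR.1 (ω₁, ⟨u ^ n, ⟨u, rfl⟩⟩) (ω₂, ⟨1, one_mem _⟩) (by simp [hu])
    exact congrArg Prod.fst h1
  · induction x using Quotient.inductionOn with
    | h L =>
      obtain ⟨ω, hω, t, ht, ρ, hρ, hL⟩ := LocalFieldExt.exists_root_generator p 𝒪 hb hm hl hlt hn L.2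
        (R := R) (fun g => by
          obtain ⟨⟨ω, ⟨_, u, rfl⟩⟩, h⟩ := hR.2 g
          exact ⟨ω.1, ω.2, u, h.symm⟩)
      refine ⟨⟨ω, hω⟩, Quotient.sound ?_⟩
      change LocalFieldExt.IsKIsomorphic p 𝒪 K⟮π ⟨ω, hω⟩⟯ L.1
      rw [← hL]
      exact LocalFieldExt.isKIsomorphic_of_roots p 𝒪 hπK ht ω hm hl hlt (hπ ⟨ω, hω⟩) hρ
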